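/- Let $\mathbb K$ be $\mathbb R$ or $\mathbb C$, let $q>0$ be real, and let $n\ge 2$, $N\ge 0$ and $k\ge 0$ be integers with $2k\le N$. Write $[m]_q=\frac{q^m-q^{-m}}{q-q^{-1}}$ (with $[m]_1=m$). Let $(\mathbb K^n)^{\otimes N}$ carry the standard inner product, let $x_1,\dots,x_n$ be the standard basis of $\mathbb K^n$ and $e_{ab}$ the matrix units. Put $$r=\sum_{a}e_{aa}\otimes e_{aa}+q^{-1}\sum_{a\ne b}e_{ab}\otimes e_{ba}+(1-q^{-2})\sum_{a>b}e_{aa}\otimes e_{bb},\qquad \mathcal H=\sum_{j=1}^{N-1}r_j,$$ where $r_j$ is $r$ acting on the tensor factors $j,j+1$. With $s_1=e_{11}-e_{22}$ let $$E_1=\sum_{j=1}^N (q^{-s_1/2})^{\otimes (j-1)}\otimes e_{21}\otimes (q^{s_1/2})^{\otimes (N-j)},\qquad F_1=\sum_{j=1}^N (q^{-s_1/2})^{\otimes (j-1)}\otimes e_{12}\otimes (q^{s_1/2})^{\otimes (N-j)},\qquad q^{H_1}=(q^{s_1})^{\otimes N}.$$ For $q\neq1$ these are the actions of $e_1,f_1,q^{h_1}\in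 U_q(\mathfrak{gl}_2)\subseteq U_q(\mathfrak{gl}_n)$ on $(\mathbb K^n)^{\otimes N}$, and $q^{\pm\varepsilon_i/2}$ ($i=1,2$) acts as $(q^{\pm e_{ii}/2})^{\otimes N}$. For $0\le m\le N$ let $W_m$ be the span of the words $x_{w_1}\otimes\cdots\otimes x_{w_N}$ with $w_i\in\{1,2\}$ in which $x_2$ occurs exactly $m$ times. Assume that the eigenvalue problem $\mathcal H b=\Lambda b$, $0\neq b\in W_k$, has distinct eigenvalues, i.e. has $\binom Nk=\dim W_k$ different eigenvalues $\Lambda\in\mathbb R$. Then: (1) Exactly $m_k=\binom Nk-\binom N{k-1}=\frac{N!}{k!\,(N-k+1)!}(N-2k+1)$ of these eigenvalues (with $\binom N{-1}=0$) have an eigenvector $0\ne b\in W_k$ with $F_1b=0$, and for these eigenvalues every eigenvector $b\in W_k$ satisfies $F_1b=0$. Let now $0\ne b\in W_k$ be any vector with $\mathcal Hb=\Lambda b$, $\Lambda\in\mathbb R$, and $F_1b=0$, and put $b_{(N-m)m}=E_1^{m-k}b$ for $m\ge k$. (2) $F_1b_{(N-m-1)(m+1)}=[N-k-m]_q\,[m-k+1]_q\,b_{(N-m)m}$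 for $k\le m\le N-k-1$; $E_1b_{k(N-k)}=0$; and $q^{H_1}b_{(N-m)m}=q^{N-2m}\,b_{(N-m)m}$ for $k\le m\le N-k$. (3) For $k\le m\le N-k$ the vector $b_{(N-m)m}$ is non-zero, lies in $W_m$ and satisfies $\mathcal Hb_{(N-m)m}=\Lambda b_{(N-m)m}$. The vectors $b_{(N-m)m}$, $k\le m\le N-k$, are pairwise orthogonal and form a basis of an $(N-2k+1)$-dimensional subspace $V$, which is invariant under $E_1$ and $F_1$ and has no invariant subspaces under them other than $0$ and $V$. If $q\ne1$, then $V$ is an irreducible $U_q(\mathfrak{gl}_2)$-module under the above action, and the vectors $\beta_i=b_{(N-k-i)(k+i)}$, $0\le i\le d-1$, $d=N-2k+1$, are a canonical basis of it: $f_1\beta_0=0$, $e_1\beta_{d-1}=0$, $e_1\beta_i=\beta_{i+1}$ and $f_1\beta_{i+1}=[i+1]_q[d-1-i]_q\,\beta_i$ for $0\le i\le d-2$, and $q^{h_1}\beta_i=q^{d-1-2i}\beta_i$ for $0\le i\le d-1$. -/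

import Mathlib

open scoped Kronecker

noncomputable section

namespace SpinChain

/-- The `q`-number `[m]_q = (q^m - q^(-m)) / (q - q^(-1))`, with its limiting value `m` at the
isotropic point `q = 1`. -/
def qInt (q : ℝ) (m : ℕ) : ℝ :=
  if q = 1 then (m : ℝ) else (q ^ m - (q ^ m)⁻¹) / (q - q⁻¹)

/-- The space `(𝕜^n)^{⊗N}`: a vector is given by its coordinates in the orthonormal basis of the
words `x_{w_1} ⊗ ⋯ ⊗ x_{w_N}`, `w : Fin N → Fin n`, and the inner product is the standard one. -/
abbrev TensorSpace (𝕜 : Type*) (n N : ℕ) : Type _ := EuclideanSpace 𝕜 (Fin N → Fin n)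

/-- The basis vector `x_{w_1} ⊗ ⋯ ⊗ x_{w_N}`. -/
def wordVec (𝕜 : Type*) [RCLike 𝕜] {n N : ℕ} (w : Fin N → Fin n) : TensorSpace 𝕜 n N :=
  EuclideanSpace.single w (1 : 𝕜)

/-- The letter `x_1`. -/
def x₁ {n : ℕ} (hn : 2 ≤ n) : Fin n := ⟨0, by omega⟩

/-- The letter `x_2`. -/
def x₂ {n : ℕ} (hn : 2 ≤ n) : Fin n := ⟨1, by omega⟩

/-- The word with `x_2` at the positions in `S` and `x_1` at all the other positions. -/
def wordOf {n N : ℕ} (hn : 2 ≤ n) (S : Finset (Fin N)) : Fin N → Fin n :=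
  fun i => if i ∈ S then x₂ hn else x₁ hn

/-- The states `𝔟_{(N-k)k}`: all linear combinations
`∑_{i_1 < ⋯ < i_k} a_{i_1 … i_k} x_1 ⋯ x_2 ⋯ x_2 ⋯ x_1` of words in `x_1, x_2` that have `x_2` at
exactly `k` positions `i_1, …, i_k`. -/
def stateSpace (𝕜 : Type*) [RCLike 𝕜] {n : ℕ} (hn : 2 ≤ n) (N k : ℕ) :
    Submodule 𝕜 (TensorSpace 𝕜 n N) :=
  Submodule.span 𝕜 {v | ∃ S : Finset (Fin N), S.card = k ∧ v = wordVec 𝕜 (wordOf hn S)}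

/-! ### The Hamiltonian -/

/-- The braid operator
`r = ∑_a e_{aa} ⊗ e_{aa} + q^(-1) ∑_{a ≠ b} e_{ab} ⊗ e_{ba}
      + (1 - q^(-2)) ∑_{a > b} e_{aa} ⊗ e_{bb}`. -/
def rMatrix (𝕜 : Type*) [RCLike 𝕜] (n : ℕ) (q : ℝ) : Matrix (Fin n × Fin n) (Fin n × Fin n) 𝕜 :=
  (∑ a : Fin n, Matrix.single a a (1 : 𝕜) ⊗ₖ Matrix.single a a (1 : 𝕜))
  + ((q⁻¹ : ℝ) : 𝕜) • (∑ a : Fin n, ∑ b : Fin n,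
      if a ≠ b then Matrix.single a b (1 : 𝕜) ⊗ₖ Matrix.single b a (1 : 𝕜) else 0)
  + ((1 - (q ^ 2)⁻¹ : ℝ) : 𝕜) • (∑ a : Fin n, ∑ b : Fin n,
      if b < a then Matrix.single a a (1 : 𝕜) ⊗ₖ Matrix.single b b (1 : 𝕜) else 0)

/-- The matrix of `1 ⊗ ⋯ ⊗ M ⊗ ⋯ ⊗ 1` with `M` acting on the tensor factors `i` and `j`. -/
def twoSite {𝕜 : Type*} [RCLike 𝕜] {n N : ℕ} (M : Matrix (Fin n × Fin n) (Fin n × Fin n) 𝕜)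
    (i j : Fin N) : Matrix (Fin N → Fin n) (Fin N → Fin n) 𝕜 :=
  fun w w' => if ∀ l, l ≠ i → l ≠ j → w l = w' l then M (w i, w j) (w' i, w' j) else 0

/-- The Hamiltonian `𝓗 = ∑_{j=1}^{N-1} r_j`, where `r_j` is `r` acting on the factors
`j, j+1`. -/
def hamiltonian (𝕜 : Type*) [RCLike 𝕜] (n N : ℕ) (q : ℝ) : Module.End 𝕜 (TensorSpace 𝕜 n N) :=
  Matrix.toEuclideanLin (∑ j : Fin (N - 1),
    twoSite (rMatrix 𝕜 n q) (⟨j.1, by omega⟩ : Fin N) (⟨j.1 + 1, by omega⟩ : Fin N))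

/-! ### The operators `E_1, F_1, q^{H_1}, q^{𝓔_i}` -/

/-- The operator `A_1 ⊗ A_2 ⊗ ⋯ ⊗ A_N` for `n × n` matrices `A_1, …, A_N`. -/
def tensorOp {𝕜 : Type*} [RCLike 𝕜] {n N : ℕ} (A : Fin N → Matrix (Fin n) (Fin n) 𝕜) :
    Module.End 𝕜 (TensorSpace 𝕜 n N) :=
  Matrix.toEuclideanLin (fun w w' => ∏ l, A l (w l) (w' l))

/-- `q^D` for the diagonal matrix `D = diag(c_1, …, c_n)`. -/
def qDiag (𝕜 : Type*) [RCLike 𝕜] {n : ℕ} (q : ℝ) (c : Fin n → ℝ) : Matrix (Fin n) (Fin n) 𝕜 :=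
  Matrix.diagonal fun a => ((q ^ c a : ℝ) : 𝕜)

/-- The diagonal of `s_1 = e_{11} - e_{22}`. -/
def sDiag {n : ℕ} (hn : 2 ≤ n) : Fin n → ℝ := Pi.single (x₁ hn) 1 - Pi.single (x₂ hn) 1

/-- `∑_j q^(-s_1/2) ⊗ ⋯ ⊗ q^(-s_1/2) ⊗ X ⊗ q^(s_1/2) ⊗ ⋯ ⊗ q^(s_1/2)`, with `X` at the position
`j`: the `N`-fold coproduct of a Chevalley generator that the fundamental representation sends
to `X`. -/
def coproductOp {𝕜 : Type*} [RCLike 𝕜] {n : ℕ} (hn : 2 ≤ n) (N : ℕ) (q : ℝ)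
    (X : Matrix (Fin n) (Fin n) 𝕜) : Module.End 𝕜 (TensorSpace 𝕜 n N) :=
  ∑ j : Fin N, tensorOp fun l =>
    if l < j then qDiag 𝕜 q (fun a => -(sDiag hn a) / 2)
    else if l = j then X
    else qDiag 𝕜 q (fun a => sDiag hn a / 2)

/-- `E_1`, the action of `e_1`, which the fundamental representation sends to `e_{21}`. -/
def E₁ (𝕜 : Type*) [RCLike 𝕜] {n : ℕ} (hn : 2 ≤ n) (N : ℕ) (q : ℝ) :
    Module.End 𝕜 (TensorSpace 𝕜 n N) :=
  coproductOp hn N q (Matrix.single (x₂ hn) (x₁ hn) 1)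

/-- `F_1`, the action of `f_1`, which the fundamental representation sends to `e_{12}`. -/
def F₁ (𝕜 : Type*) [RCLike 𝕜] {n : ℕ} (hn : 2 ≤ n) (N : ℕ) (q : ℝ) :
    Module.End 𝕜 (TensorSpace 𝕜 n N) :=
  coproductOp hn N q (Matrix.single (x₁ hn) (x₂ hn) 1)

/-- `q^{H_1} = q^{s_1} ⊗ ⋯ ⊗ q^{s_1}`. -/
def qH₁ (𝕜 : Type*) [RCLike 𝕜] {n : ℕ} (hn : 2 ≤ n) (N : ℕ) (q : ℝ) :
    Module.End 𝕜 (TensorSpace 𝕜 n N) :=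
  tensorOp fun _ => qDiag 𝕜 q (sDiag hn)

/-- `q^{t 𝓔_a} = q^{t e_{aa}} ⊗ ⋯ ⊗ q^{t e_{aa}}` for a letter `a` and a real number `t`. -/
def qEps (𝕜 : Type*) [RCLike 𝕜] {n : ℕ} (N : ℕ) (q t : ℝ) (a : Fin n) :
    Module.End 𝕜 (TensorSpace 𝕜 n N) :=
  tensorOp fun _ => qDiag 𝕜 q (Pi.single a t)

/-! ### The quantum algebra `U_q(gl_2)` -/

/-- Generators of `U_q(gl_2)`: `e`, `f`, and `q^{ε_i/2}`, `q^{-ε_i/2}` for `i = 1, 2`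
(the index `i` runs through `Fin 2 = {0, 1}`). -/
inductive UqGen : Type
  | e : UqGen
  | f : UqGen
  | kPos (i : Fin 2) : UqGen
  | kNeg (i : Fin 2) : UqGen

/-- `q^{h/2} = q^{ε_1/2} q^{-ε_2/2}` in the free algebra. -/
def freeQHalfH (𝕜 : Type*) [RCLike 𝕜] : FreeAlgebra 𝕜 UqGen :=
  FreeAlgebra.ι 𝕜 (UqGen.kPos 0) * FreeAlgebra.ι 𝕜 (UqGen.kNeg 1)

/-- `q^{-h/2} = q^{-ε_1/2} q^{ε_2/2}` in the free algebra. -/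
def freeQHalfHInv (𝕜 : Type*) [RCLike 𝕜] : FreeAlgebra 𝕜 UqGen :=
  FreeAlgebra.ι 𝕜 (UqGen.kNeg 0) * FreeAlgebra.ι 𝕜 (UqGen.kPos 1)

/-- The defining relations of `U_q(gl_2)` (for `q ≠ 1`). They imply
`q^{h/2} f = q f q^{h/2}` and `q^{h/2} e = q^{-1} e q^{h/2}`, and that `q^{ε_1 + ε_2}` is
central. -/
inductive UqRel (𝕜 : Type*) [RCLike 𝕜] (q : ℝ) :
    FreeAlgebra 𝕜 UqGen → FreeAlgebra 𝕜 UqGen → Prop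
  | pos_neg (i : Fin 2) :
      UqRel 𝕜 q (FreeAlgebra.ι 𝕜 (UqGen.kPos i) * FreeAlgebra.ι 𝕜 (UqGen.kNeg i)) 1
  | neg_pos (i : Fin 2) :
      UqRel 𝕜 q (FreeAlgebra.ι 𝕜 (UqGen.kNeg i) * FreeAlgebra.ι 𝕜 (UqGen.kPos i)) 1
  | comm :
      UqRel 𝕜 q (FreeAlgebra.ι 𝕜 (UqGen.kPos 0) * FreeAlgebra.ι 𝕜 (UqGen.kPos 1))
        (FreeAlgebra.ι 𝕜 (UqGen.kPos 1) * FreeAlgebra.ι 𝕜 (UqGen.kPos 0))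
  | k_f₁ :
      UqRel 𝕜 q (FreeAlgebra.ι 𝕜 (UqGen.kPos 0) * FreeAlgebra.ι 𝕜 UqGen.f)
        (((q ^ (1 / 2 : ℝ) : ℝ) : 𝕜) •
          (FreeAlgebra.ι 𝕜 UqGen.f * FreeAlgebra.ι 𝕜 (UqGen.kPos 0)))
  | k_f₂ :
      UqRel 𝕜 q (FreeAlgebra.ι 𝕜 (UqGen.kPos 1) * FreeAlgebra.ι 𝕜 UqGen.f)
        (((q ^ (-(1 / 2) : ℝ) : ℝ) : 𝕜) •
          (FreeAlgebra.ι 𝕜 UqGen.f * FreeAlgebra.ι 𝕜 (UqGen.kPos 1)))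
  | k_e₁ :
      UqRel 𝕜 q (FreeAlgebra.ι 𝕜 (UqGen.kPos 0) * FreeAlgebra.ι 𝕜 UqGen.e)
        (((q ^ (-(1 / 2) : ℝ) : ℝ) : 𝕜) •
          (FreeAlgebra.ι 𝕜 UqGen.e * FreeAlgebra.ι 𝕜 (UqGen.kPos 0)))
  | k_e₂ :
      UqRel 𝕜 q (FreeAlgebra.ι 𝕜 (UqGen.kPos 1) * FreeAlgebra.ι 𝕜 UqGen.e)
        (((q ^ (1 / 2 : ℝ) : ℝ) : 𝕜) •
          (FreeAlgebra.ι 𝕜 UqGen.e * FreeAlgebra.ι 𝕜 (UqGen.kPos 1)))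
  | f_e :
      UqRel 𝕜 q
        (FreeAlgebra.ι 𝕜 UqGen.f * FreeAlgebra.ι 𝕜 UqGen.e
          - FreeAlgebra.ι 𝕜 UqGen.e * FreeAlgebra.ι 𝕜 UqGen.f)
        ((((q - q⁻¹)⁻¹ : ℝ) : 𝕜) • (freeQHalfH 𝕜 ^ 2 - freeQHalfHInv 𝕜 ^ 2))

/-- The quantum algebra `U_q(gl_2)`. -/
abbrev UqGl₂ (𝕜 : Type*) [RCLike 𝕜] (q : ℝ) : Type _ := RingQuot (UqRel 𝕜 q)

namespace UqGl₂

/-- The class of a generator in `U_q(gl_2)`. -/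
def gen (𝕜 : Type*) [RCLike 𝕜] (q : ℝ) (g : UqGen) : UqGl₂ 𝕜 q :=
  RingQuot.mkAlgHom 𝕜 (UqRel 𝕜 q) (FreeAlgebra.ι 𝕜 g)

/-- The element `q^h = (q^{ε_1/2} q^{-ε_2/2})^2`. -/
def qh (𝕜 : Type*) [RCLike 𝕜] (q : ℝ) : UqGl₂ 𝕜 q :=
  (gen 𝕜 q (UqGen.kPos 0) * gen 𝕜 q (UqGen.kNeg 1)) ^ 2

end UqGl₂

/-- A representation `ρ` of an algebra on a non-zero space `V` is irreducible if `0` and `V` are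
its only invariant subspaces. -/
def IsIrreducibleRep {𝕜 A V : Type*} [Field 𝕜] [Ring A] [Algebra 𝕜 A] [AddCommGroup V]
    [Module 𝕜 V] (ρ : A →ₐ[𝕜] Module.End 𝕜 V) : Prop :=
  Nontrivial V ∧
    ∀ W : Submodule 𝕜 V, (∀ u : A, ∀ w ∈ W, ρ u w ∈ W) → W = ⊥ ∨ W = ⊤

/-- A canonical basis `β_0, …, β_{d-1}` of a `d`-dimensional representation of `U_q(gl_2)`:
`f β_0 = 0`, `e β_{d-1} = 0`, `e β_i = β_{i+1}`, `f β_{i+1} = [i+1]_q [d-1-i]_q β_i` and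
`q^h β_i = q^{d-1-2i} β_i`. -/
def IsCanonicalBasis {𝕜 V : Type*} [RCLike 𝕜] [AddCommGroup V] [Module 𝕜 V] {q : ℝ} {d : ℕ}
    (ρ : UqGl₂ 𝕜 q →ₐ[𝕜] Module.End 𝕜 V) (β : Module.Basis (Fin d) 𝕜 V) : Prop :=
  (∀ i : Fin d, i.1 = 0 → ρ (UqGl₂.gen 𝕜 q UqGen.f) (β i) = 0) ∧
  (∀ i : Fin d, i.1 + 1 = d → ρ (UqGl₂.gen 𝕜 q UqGen.e) (β i) = 0) ∧
  (∀ i j : Fin d, j.1 = i.1 + 1 → ρ (UqGl₂.gen 𝕜 q UqGen.e) (β i) = β j) ∧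
  (∀ i j : Fin d, j.1 = i.1 + 1 → ρ (UqGl₂.gen 𝕜 q UqGen.f) (β j) =
    ((qInt q (i.1 + 1) * qInt q (d - 1 - i.1) : ℝ) : 𝕜) • β i) ∧
  (∀ i : Fin d, ρ (UqGl₂.qh 𝕜 q) (β i) = ((q ^ ((d : ℤ) - 1 - 2 * (i.1 : ℤ)) : ℝ) : 𝕜) • β i)

/-- The representation `ρ` of `U_q(gl_2)` on the subspace `V` of `(𝕜^n)^{⊗N}` is the restriction
to `V` of the action of `U_q(gl_2) ⊆ U_q(gl_n)` on `(𝕜^n)^{⊗N}`. -/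
def IsRestrictedAction {𝕜 : Type*} [RCLike 𝕜] {n : ℕ} (hn : 2 ≤ n) {N : ℕ} {q : ℝ}
    {V : Submodule 𝕜 (TensorSpace 𝕜 n N)} (ρ : UqGl₂ 𝕜 q →ₐ[𝕜] Module.End 𝕜 V) : Prop :=
  ∀ v : V,
    (ρ (UqGl₂.gen 𝕜 q UqGen.e) v : TensorSpace 𝕜 n N) = E₁ 𝕜 hn N q v ∧
    (ρ (UqGl₂.gen 𝕜 q UqGen.f) v : TensorSpace 𝕜 n N) = F₁ 𝕜 hn N q v ∧
    (ρ (UqGl₂.gen 𝕜 q (UqGen.kPos 0)) v : TensorSpace 𝕜 n N) = qEps 𝕜 N q (1 / 2) (x₁ hn) v ∧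
    (ρ (UqGl₂.gen 𝕜 q (UqGen.kNeg 0)) v : TensorSpace 𝕜 n N) = qEps 𝕜 N q (-(1 / 2)) (x₁ hn) v ∧
    (ρ (UqGl₂.gen 𝕜 q (UqGen.kPos 1)) v : TensorSpace 𝕜 n N) = qEps 𝕜 N q (1 / 2) (x₂ hn) v ∧
    (ρ (UqGl₂.gen 𝕜 q (UqGen.kNeg 1)) v : TensorSpace 𝕜 n N) = qEps 𝕜 N q (-(1 / 2)) (x₂ hn) v

/-! ### Eigenvalues and sectors -/

/-- `b` is an eigenvector of `𝓗` with eigenvalue `Λ` of the form `𝔟_{(N-k)k}`. -/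
def IsEigenstate {𝕜 : Type*} [RCLike 𝕜] {n : ℕ} (hn : 2 ≤ n) {N : ℕ} (k : ℕ) (q Λ : ℝ)
    (b : TensorSpace 𝕜 n N) : Prop :=
  b ∈ stateSpace 𝕜 hn N k ∧ b ≠ 0 ∧ hamiltonian 𝕜 n N q b = (Λ : 𝕜) • b

/-- The eigenvalues of the problem `𝓗 𝔟_{(N-k)k} = Λ 𝔟_{(N-k)k}`. -/
def eigenvalues (𝕜 : Type*) [RCLike 𝕜] {n : ℕ} (hn : 2 ≤ n) (N k : ℕ) (q : ℝ) : Set ℝ :=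
  {Λ | ∃ b : TensorSpace 𝕜 n N, IsEigenstate hn k q Λ b}

/-- The eigenvalues in the `k`-sector: those with an eigenstate `b` of the form `𝔟_{(N-k)k}` that
is a highest-weight vector, `F_1 b = 0`. -/
def sectorEigenvalues (𝕜 : Type*) [RCLike 𝕜] {n : ℕ} (hn : 2 ≤ n) (N k : ℕ) (q : ℝ) : Set ℝ :=
  {Λ | ∃ b : TensorSpace 𝕜 n N, IsEigenstate hn k q Λ b ∧ F₁ 𝕜 hn N q b = 0}

/-- `b_{(N-m)m} = E_1^{m-k} b` for `m ≥ k`. -/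
def orbitVec {𝕜 : Type*} [RCLike 𝕜] {n : ℕ} (hn : 2 ≤ n) {N : ℕ} (k : ℕ) (q : ℝ)
    (b : TensorSpace 𝕜 n N) (m : ℕ) : TensorSpace 𝕜 n N :=
  (E₁ 𝕜 hn N q ^ (m - k)) b

/-- The span of the orbit `b_{(N-m)m}`, `k ≤ m ≤ N - k`. -/
def orbitSpan {𝕜 : Type*} [RCLike 𝕜] {n : ℕ} (hn : 2 ≤ n) {N : ℕ} (k : ℕ) (q : ℝ)
    (b : TensorSpace 𝕜 n N) : Submodule 𝕜 (TensorSpace 𝕜 n N) :=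
  Submodule.span 𝕜 (orbitVec hn k q b '' Set.Icc k (N - k))

end SpinChain

end

/-!
The operator `F₁` is the adjoint of `E₁`, both shift the pairwise orthogonal spaces `W_m`, and
`F₁ E₁ - E₁ F₁` acts on `W_m` as `[N - 2m]_q`: the commutators of distinct summands of the
coproducts vanish, and the remaining ones telescope. If `F₁ b = 0` with `b ∈ W_k`, this gives
`F₁ E₁^(i+1) b = [i + 1]_q [N - 2k - i]_q E₁^i b` with positive coefficients for `i < N - 2k`, and
`F₁ E₁^(N-2k+1) b = 0`, whence `E₁^(N-2k+1) b = 0` because `F₁` is the adjoint of `E₁`. The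
Hamiltonian commutes with `E₁` because `r` commutes with the coproduct on two factors, and it is
Hermitian, so it also commutes with `F₁`.

For the count of eigenvalues, `E₁` is injective on `W_(k-1)`, so the kernel of `F₁` on `W_k` has
dimension at most `binom(N, k) - binom(N, k-1)`. Every eigenvalue on `W_k` is an eigenvalue on this
kernel or, through `F₁`, on `W_(k-1)`. As there are `binom(N, k)` of them, both bounds are attained
and the two kinds of eigenvalues are disjoint.
-/

namespace SpinChain

section QNumbers

/-- The `q`-number `[x]_q` of a real number `x`, extending `qInt` so that the weights `N - 2m` of
the states need no truncated subtraction. -/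
noncomputable def qNum (q x : ℝ) : ℝ := if q = 1 then x else (q ^ x - q ^ (-x)) / (q - q⁻¹)

theorem qNum_zero (q : ℝ) : qNum q 0 = 0 := by simp [qNum]

theorem qInt_eq_qNum {q : ℝ} (hq : 0 < q) (m : ℕ) : qInt q m = qNum q m := by
  rw [qInt, qNum, Real.rpow_neg hq.le, Real.rpow_natCast]

variable {q : ℝ}

theorem sub_inv_ne_zero (hq : 0 < q) (h1 : q ≠ 1) : q - q⁻¹ ≠ 0 := by
  rw [sub_ne_zero, Ne, ← mul_eq_one_iff_eq_inv₀ hq.ne', mul_self_eq_one_iff]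
  exact not_or_intro h1 (by linarith)

theorem mul_qNum (hq : 0 < q) (h1 : q ≠ 1) (x : ℝ) :
    (q - q⁻¹) * qNum q x = q ^ x - q ^ (-x) := by
  rw [qNum, if_neg h1, mul_div_cancel₀ _ (sub_inv_ne_zero hq h1)]

theorem qNum_one_right (hq : 0 < q) : qNum q 1 = 1 := by
  by_cases h1 : q = 1
  · rw [qNum, if_pos h1]
  · refine mul_left_cancel₀ (sub_inv_ne_zero hq h1) ?_
    rw [mul_qNum hq h1, Real.rpow_one, Real.rpow_neg_one, mul_one]

theorem qNum_mul_add (hq : 0 < q) (x y : ℝ) :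
    qNum q x * qNum q (y + 1) + qNum q (y - x) = qNum q (x + 1) * qNum q y := by
  by_cases h1 : q = 1
  · simp only [qNum, if_pos h1]
    ring
  · have hd := sub_inv_ne_zero hq h1
    refine mul_left_cancel₀ (mul_ne_zero hd hd) ?_
    calc _ = ((q - q⁻¹) * qNum q x) * ((q - q⁻¹) * qNum q (y + 1))
          + (q - q⁻¹) * ((q - q⁻¹) * qNum q (y - x)) := by ring
      _ = ((q - q⁻¹) * qNum q (x + 1)) * ((q - q⁻¹) * qNum q y) := by
        simp only [mul_qNum hq h1, Real.rpow_neg hq.le, Real.rpow_add hq, Real.rpow_sub hq,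
          Real.rpow_one]
        field_simp
        ring
      _ = _ := by ring

theorem qNum_pos {x : ℝ} (hq : 0 < q) (hx : 0 < x) : 0 < qNum q x := by
  rcases lt_trichotomy q 1 with h | h | h
  · rw [qNum, if_neg h.ne]
    exact div_pos_of_neg_of_neg
      (sub_neg.2 (Real.rpow_lt_rpow_of_exponent_gt hq h (by linarith)))
      (sub_neg.2 (h.trans ((one_lt_inv₀ hq).2 h)))
  · rwa [qNum, if_pos h]
  · rw [qNum, if_neg h.ne']
    exact div_pos (sub_pos.2 (Real.rpow_lt_rpow_of_exponent_lt h (by linarith)))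
      (sub_pos.2 ((inv_lt_one_of_one_lt₀ h).trans h))

/-- The terms with `σ i = 0` vanish, so `(q - q⁻¹) σ i = q ^ σ i - q ^ (-σ i)` makes the sum
telescope. -/
theorem sum_mul_prod_rpow_eq_qNum {ι : Type*} [Fintype ι] [LinearOrder ι] (hq : 0 < q)
    {σ : ι → ℝ} (hσ : ∀ i, σ i = -1 ∨ σ i = 0 ∨ σ i = 1) :
    ∑ i, σ i * (∏ l with l < i, q ^ (-σ l)) * ∏ l with i < l, q ^ σ l = qNum q (∑ i, σ i) := by
  by_cases h1 : q = 1
  · simp [h1, qNum]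
  have telescoped := Finset.prod_sub_ordered Finset.univ (fun i => q ^ σ i)
    (fun i => q ^ σ i - q ^ (-σ i))
  have scaled (i : ι) : (q - q⁻¹) * σ i = q ^ σ i - q ^ (-σ i) := by
    rcases hσ i with h | h | h <;> simp [h, Real.rpow_neg_one]
  refine mul_left_cancel₀ (sub_inv_ne_zero hq h1) ?_
  calc _ = ∑ i, (q ^ σ i - q ^ (-σ i)) * (∏ l with l < i, q ^ (-σ l)) *
          ∏ l with i < l, q ^ σ l := by
        simp only [Finset.mul_sum, ← scaled, mul_assoc]
    _ = ∏ i, q ^ σ i - ∏ i, q ^ (-σ i) := by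
        simp only [sub_sub_cancel] at telescoped
        rw [telescoped, sub_sub_cancel]
    _ = _ := by
        rw [mul_qNum hq h1, ← Finset.sum_neg_distrib, Real.rpow_sum_of_pos hq,
          Real.rpow_sum_of_pos hq]

end QNumbers

section TensorMatrix

variable {ι α R : Type*} [Fintype ι]

/-- The matrix of `⨂_l A l`, indexed by words, over a commutative semiring. -/
def tensorMatrix [CommSemiring R] (A : ι → Matrix α α R) : Matrix (ι → α) (ι → α) R :=
  Matrix.of fun w w' => ∏ l, A l (w l) (w' l)

theorem tensorMatrix_mul [CommSemiring R] [Fintype α] [DecidableEq ι] (A B : ι → Matrix α α R) :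
    tensorMatrix A * tensorMatrix B = tensorMatrix fun l => A l * B l := by
  ext w w'
  simp only [tensorMatrix, Matrix.mul_apply, Matrix.of_apply, Finset.prod_univ_sum,
    Fintype.piFinset_univ, Finset.prod_mul_distrib]

theorem tensorMatrix_smul [CommSemiring R] (c : ι → R) (A : ι → Matrix α α R) :
    tensorMatrix (fun l => c l • A l) = (∏ l, c l) • tensorMatrix A := by
  ext w w'
  simp only [tensorMatrix, Matrix.of_apply, Matrix.smul_apply, smul_eq_mul,
    Finset.prod_mul_distrib]

theorem tensorMatrix_diagonal [CommSemiring R] [DecidableEq α] (d : ι → α → R) :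
    tensorMatrix (fun l => Matrix.diagonal (d l)) = Matrix.diagonal fun w => ∏ l, d l (w l) := by
  ext w w'
  rw [tensorMatrix, Matrix.of_apply, Matrix.diagonal_apply]
  split_ifs with h
  · simp [h]
  · obtain ⟨l, hl⟩ := Function.ne_iff.1 h
    exact Finset.prod_eq_zero (Finset.mem_univ l) (Matrix.diagonal_apply_ne _ hl)

theorem conjTranspose_tensorMatrix [CommSemiring R] [StarRing R] (A : ι → Matrix α α R) :
    (tensorMatrix A).conjTranspose = tensorMatrix fun l => (A l).conjTranspose := by
  ext w w'
  simp only [tensorMatrix, Matrix.conjTranspose_apply, Matrix.of_apply, star_prod]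

theorem commute_tensorMatrix [CommSemiring R] [Fintype α] [DecidableEq ι] {A B : ι → Matrix α α R}
    {c : ι → R} (h : ∀ l, A l * B l = c l • (B l * A l)) (hc : ∏ l, c l = 1) :
    Commute (tensorMatrix A) (tensorMatrix B) := by
  rw [Commute, SemiconjBy, tensorMatrix_mul, tensorMatrix_mul, funext h, tensorMatrix_smul, hc,
    one_smul]

end TensorMatrix

section QDiag

variable {𝕜 : Type*} [RCLike 𝕜] {n : ℕ} {q : ℝ}

theorem qDiag_mul_qDiag (hq : 0 < q) (c c' : Fin n → ℝ) :
    qDiag 𝕜 q c * qDiag 𝕜 q c' = qDiag 𝕜 q (c + c') := by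
  simp only [qDiag, Matrix.diagonal_mul_diagonal, ← RCLike.ofReal_mul, ← Real.rpow_add hq,
    Pi.add_apply]

theorem conjTranspose_qDiag (c : Fin n → ℝ) : (qDiag 𝕜 q c).conjTranspose = qDiag 𝕜 q c := by
  rw [qDiag, Matrix.diagonal_conjTranspose]
  exact congrArg Matrix.diagonal (funext fun a => RCLike.conj_ofReal _)

theorem qDiag_mul_single (hq : 0 < q) (c : Fin n → ℝ) (a b : Fin n) :
    qDiag 𝕜 q c * Matrix.single a b 1 =
      ((q ^ (c a - c b) : ℝ) : 𝕜) • (Matrix.single a b 1 * qDiag 𝕜 q c) := by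
  ext i j
  simp only [qDiag, Matrix.diagonal_mul, Matrix.smul_apply, Matrix.mul_diagonal,
    Matrix.single_apply, smul_eq_mul]
  split_ifs with h
  · rw [← h.1, ← h.2, one_mul, mul_one, ← RCLike.ofReal_mul, ← Real.rpow_add hq, sub_add_cancel]
  · simp

theorem single_mul_qDiag (hq : 0 < q) (c : Fin n → ℝ) (a b : Fin n) :
    Matrix.single a b 1 * qDiag 𝕜 q c =
      ((q ^ (c b - c a) : ℝ) : 𝕜) • (qDiag 𝕜 q c * Matrix.single a b 1) := by
  rw [qDiag_mul_single hq, smul_smul, ← RCLike.ofReal_mul, ← Real.rpow_add hq,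
    sub_add_sub_cancel, sub_self, Real.rpow_zero, RCLike.ofReal_one, one_smul]

end QDiag

theorem prod_ite_lt_eq {ι M : Type*} [Fintype ι] [LinearOrder ι] [CommMonoid M] (j : ι)
    (f g h : ι → M) : ∏ l, (if l < j then f l else if l = j then g l else h l) =
      (∏ l with l < j, f l) * g j * ∏ l with j < l, h l := by
  have split (l : ι) : (if l < j then f l else if l = j then g l else h l) =
      (if l < j then f l else 1) * (if l = j then g l else 1) * (if j < l then h l else 1) := by
    rcases lt_trichotomy l j with hl | rfl | hl
    · simp [hl, hl.ne, hl.not_gt]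
    · simp
    · simp [hl, hl.ne', hl.not_gt]
  simp only [split, Finset.prod_mul_distrib, Finset.prod_ite_eq', Finset.mem_univ, if_true,
    Finset.prod_filter]

section Coproduct

variable {𝕜 : Type*} [RCLike 𝕜] {n N : ℕ} (hn : 2 ≤ n) {q : ℝ}

/-- The `j`-th summand of the coproduct, `X` at the position `j` between powers of `q^{s_1}`, as a
matrix. -/
noncomputable def siteMatrix (q : ℝ) (X : Matrix (Fin n) (Fin n) 𝕜) (j : Fin N) :
    Matrix (Fin N → Fin n) (Fin N → Fin n) 𝕜 :=
  tensorMatrix fun l =>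
    if l < j then qDiag 𝕜 q (fun a => -(sDiag hn a) / 2)
    else if l = j then X
    else qDiag 𝕜 q (fun a => sDiag hn a / 2)

/-- The matrix of `coproductOp`. -/
noncomputable def coproductMatrix (N : ℕ) (q : ℝ) (X : Matrix (Fin n) (Fin n) 𝕜) :
    Matrix (Fin N → Fin n) (Fin N → Fin n) 𝕜 :=
  ∑ j, siteMatrix hn q X j

theorem coproductOp_eq_toLpLinAlgEquiv (X : Matrix (Fin n) (Fin n) 𝕜) :
    coproductOp hn N q X = Matrix.toLpLinAlgEquiv 2 (coproductMatrix hn N q X) := by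
  rw [coproductMatrix, map_sum]
  rfl

theorem conjTranspose_coproductMatrix (X : Matrix (Fin n) (Fin n) 𝕜) :
    (coproductMatrix hn N q X).conjTranspose = coproductMatrix hn N q X.conjTranspose := by
  simp only [coproductMatrix, siteMatrix, Matrix.conjTranspose_sum, conjTranspose_tensorMatrix,
    apply_ite Matrix.conjTranspose, conjTranspose_qDiag]

theorem commute_siteMatrix_of_lt (hq : 0 < q) {i j : Fin N} (hij : i < j) (a b : Fin n) :
    Commute (siteMatrix hn q (Matrix.single a b (1 : 𝕜)) i)
      (siteMatrix hn q (Matrix.single b a 1) j) := by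
  let c : ℝ := (sDiag hn a - sDiag hn b) / 2
  refine commute_tensorMatrix (c := fun l =>
    if l = i then ((q ^ c : ℝ) : 𝕜) else if l = j then ((q ^ (-c) : ℝ) : 𝕜) else 1) (fun l => ?_) ?_
  · have comm (s t : Fin n → ℝ) :
        qDiag 𝕜 q s * qDiag 𝕜 q t = (1 : 𝕜) • (qDiag 𝕜 q t * qDiag 𝕜 q s) := by
      rw [qDiag_mul_qDiag hq, qDiag_mul_qDiag hq, add_comm, one_smul]
    rcases lt_trichotomy l i with hi | rfl | hi
    · simp only [hi, hi.trans hij, hi.ne, (hi.trans hij).ne, if_true, if_false]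
      exact comm _ _
    · simp only [hij, lt_irrefl, if_true, if_false, single_mul_qDiag hq]
      congr 4
      simp only [c]; ring
    · rcases lt_trichotomy l j with hj | rfl | hj
      · simp only [hi.not_gt, hi.ne', hj, hj.ne, if_true, if_false]
        exact comm _ _
      · simp only [hi.not_gt, hi.ne', lt_irrefl, if_true, if_false, qDiag_mul_single hq]
        congr 4
        simp only [c]; ring
      · simp only [hi.not_gt, hi.ne', hj.not_gt, hj.ne', if_false]
        exact comm _ _
  · rw [Fintype.prod_eq_mul i j hij.ne (fun l hl => by rw [if_neg hl.1, if_neg hl.2]), if_pos rfl,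
      if_neg hij.ne', if_pos rfl, ← RCLike.ofReal_mul, ← Real.rpow_add hq, add_neg_cancel,
      Real.rpow_zero, RCLike.ofReal_one]

theorem commute_siteMatrix (hq : 0 < q) {i j : Fin N} (hij : i ≠ j) (a b : Fin n) :
    Commute (siteMatrix hn q (Matrix.single a b (1 : 𝕜)) i)
      (siteMatrix hn q (Matrix.single b a 1) j) := by
  rcases hij.lt_or_gt with h | h
  · exact commute_siteMatrix_of_lt hn hq h a b
  · exact (commute_siteMatrix_of_lt hn hq h b a).symm

theorem siteMatrix_single_mul_siteMatrix_single (hq : 0 < q) (i : Fin N) (a b : Fin n) :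
    siteMatrix hn q (Matrix.single a b (1 : 𝕜)) i * siteMatrix hn q (Matrix.single b a 1) i =
      Matrix.diagonal fun w => (∏ l with l < i, ((q ^ (-sDiag hn (w l)) : ℝ) : 𝕜)) *
        (Pi.single a 1 : Fin n → 𝕜) (w i) * ∏ l with i < l, ((q ^ sDiag hn (w l) : ℝ) : 𝕜) := by
  have diag (l : Fin N) :
      (if l < i then qDiag 𝕜 q (fun a => -(sDiag hn a) / 2)
        else if l = i then Matrix.single a b 1 else qDiag 𝕜 q (fun a => sDiag hn a / 2)) *
      (if l < i then qDiag 𝕜 q (fun a => -(sDiag hn a) / 2)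
        else if l = i then Matrix.single b a 1 else qDiag 𝕜 q (fun a => sDiag hn a / 2)) =
      Matrix.diagonal (fun x => if l < i then ((q ^ (-sDiag hn x) : ℝ) : 𝕜)
        else if l = i then (Pi.single a 1 : Fin n → 𝕜) x else ((q ^ sDiag hn x : ℝ) : 𝕜)) := by
    split_ifs
    · rw [qDiag_mul_qDiag hq, qDiag]
      simp only [Pi.add_apply, add_halves]
    · rw [Matrix.single_mul_single_same, mul_one, Matrix.diagonal_single]
    · rw [qDiag_mul_qDiag hq, qDiag]
      simp only [Pi.add_apply, add_halves]
  simp only [siteMatrix, tensorMatrix_mul, diag, tensorMatrix_diagonal, prod_ite_lt_eq]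

theorem x₁_lt_x₂ : x₁ hn < x₂ hn := Fin.mk_lt_mk.2 one_pos

theorem x₁_ne_x₂ : x₁ hn ≠ x₂ hn := (x₁_lt_x₂ hn).ne

theorem x₂_lt_of_ne {a : Fin n} (h₁ : a ≠ x₁ hn) (h₂ : a ≠ x₂ hn) : x₂ hn < a := by
  simp only [x₁, x₂, ne_eq, Fin.ext_iff, Fin.lt_def] at *
  omega

theorem sDiag_x₁ : sDiag hn (x₁ hn) = 1 := by
  simp [sDiag, x₁_ne_x₂ hn]

theorem sDiag_x₂ : sDiag hn (x₂ hn) = -1 := by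
  simp [sDiag, (x₁_ne_x₂ hn).symm]

theorem sDiag_of_ne {a : Fin n} (h₁ : a ≠ x₁ hn) (h₂ : a ≠ x₂ hn) :
    sDiag hn a = 0 := by
  simp [sDiag, h₁, h₂]

theorem sDiag_eq_neg_one_or_zero_or_one (a : Fin n) :
    sDiag hn a = -1 ∨ sDiag hn a = 0 ∨ sDiag hn a = 1 := by
  simp only [sDiag, Pi.sub_apply, Pi.single_apply, x₁, x₂]
  split_ifs with h h'
  · simp [h] at h'
  all_goals simp

theorem ofReal_sDiag (a : Fin n) : ((sDiag hn a : ℝ) : 𝕜) =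
    (Pi.single (x₁ hn) 1 : Fin n → 𝕜) a - (Pi.single (x₂ hn) 1 : Fin n → 𝕜) a := by
  simp only [sDiag, Pi.sub_apply, Pi.single_apply, RCLike.ofReal_sub, apply_ite ((↑) : ℝ → 𝕜),
    RCLike.ofReal_one, RCLike.ofReal_zero]

theorem commutator_coproductMatrix (hq : 0 < q) :
    coproductMatrix hn N q (Matrix.single (x₁ hn) (x₂ hn) (1 : 𝕜)) *
        coproductMatrix hn N q (Matrix.single (x₂ hn) (x₁ hn) 1) -
      coproductMatrix hn N q (Matrix.single (x₂ hn) (x₁ hn) 1) *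
        coproductMatrix hn N q (Matrix.single (x₁ hn) (x₂ hn) 1) =
      Matrix.diagonal fun w => ((qNum q (∑ l, sDiag hn (w l)) : ℝ) : 𝕜) := by
  set F := siteMatrix hn q (N := N) (Matrix.single (x₁ hn) (x₂ hn) (1 : 𝕜)) with hF
  set E := siteMatrix hn q (N := N) (Matrix.single (x₂ hn) (x₁ hn) (1 : 𝕜)) with hE
  have off_diagonal (i j : Fin N) (hij : j ≠ i) : F i * E j - E j * F i = 0 :=
    sub_eq_zero.2 (commute_siteMatrix hn hq hij.symm _ _).eq
  calc (∑ i, F i) * (∑ j, E j) - (∑ j, E j) * ∑ i, F i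
      = ∑ i, (F i * E i - E i * F i) := by
        rw [Finset.sum_mul_sum, Finset.sum_mul_sum, Finset.sum_comm, ← Finset.sum_sub_distrib]
        refine Finset.sum_congr rfl fun j _ => ?_
        rw [← Finset.sum_sub_distrib]
        exact Fintype.sum_eq_single j fun i hi => off_diagonal i j hi.symm
    _ = ∑ i, Matrix.diagonal fun w => ((sDiag hn (w i) * (∏ l with l < i, q ^ (-sDiag hn (w l))) *
          ∏ l with i < l, q ^ sDiag hn (w l) : ℝ) : 𝕜) := by
        refine Finset.sum_congr rfl fun i _ => ?_
        rw [hF, hE, siteMatrix_single_mul_siteMatrix_single hn hq,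
          siteMatrix_single_mul_siteMatrix_single hn hq, Matrix.diagonal_sub]
        refine congrArg Matrix.diagonal (funext fun w => ?_)
        simp only [RCLike.ofReal_mul, RCLike.ofReal_prod, ofReal_sDiag]
        ring
    _ = _ := by
        ext w w'
        simp only [Matrix.sum_apply, Matrix.diagonal_apply]
        split_ifs
        · rw [← RCLike.ofReal_sum,
            sum_mul_prod_rpow_eq_qNum hq fun i => sDiag_eq_neg_one_or_zero_or_one hn (w i)]
        · exact Finset.sum_const_zero

end Coproduct

section WeightOp

variable {𝕜 : Type*} [RCLike 𝕜] {n N : ℕ} {q : ℝ}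

/-- The group-like operator `q^D ⊗ ⋯ ⊗ q^D` for the diagonal matrix `D = diag(c_1, …, c_n)`; both
`qH₁` and `qEps` are of this form. -/
noncomputable def weightOp (𝕜 : Type*) [RCLike 𝕜] {n : ℕ} (N : ℕ) (q : ℝ) (c : Fin n → ℝ) :
    Module.End 𝕜 (TensorSpace 𝕜 n N) :=
  tensorOp fun _ => qDiag 𝕜 q c

theorem qH₁_eq_weightOp (hn : 2 ≤ n) : qH₁ 𝕜 hn N q = weightOp 𝕜 N q (sDiag hn) := rfl

theorem qEps_eq_weightOp (t : ℝ) (a : Fin n) : qEps 𝕜 N q t a = weightOp 𝕜 N q (Pi.single a t) :=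
  rfl

theorem weightOp_eq_diagonal (hq : 0 < q) (c : Fin n → ℝ) : weightOp 𝕜 N q c =
    Matrix.toLpLinAlgEquiv 2 (Matrix.diagonal fun w => ((q ^ ∑ l, c (w l) : ℝ) : 𝕜)) := by
  refine congrArg (Matrix.toLpLinAlgEquiv 2) ((tensorMatrix_diagonal _).trans ?_)
  simp only [← RCLike.ofReal_prod, Real.rpow_sum_of_pos hq]

theorem weightOp_mul (hq : 0 < q) (c c' : Fin n → ℝ) :
    weightOp 𝕜 N q c * weightOp 𝕜 N q c' = weightOp 𝕜 N q (c + c') := by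
  simp only [weightOp_eq_diagonal hq, ← map_mul, Matrix.diagonal_mul_diagonal, ← Real.rpow_add hq,
    ← Finset.sum_add_distrib, Pi.add_apply]

theorem weightOp_zero (hq : 0 < q) : weightOp 𝕜 N q (0 : Fin n → ℝ) = 1 := by
  simp only [weightOp_eq_diagonal hq, Pi.zero_apply, Finset.sum_const_zero, Real.rpow_zero,
    Matrix.diagonal_one, map_one]

theorem toLpLinAlgEquiv_diagonal_wordVec (d : (Fin N → Fin n) → 𝕜) (w : Fin N → Fin n) :
    Matrix.toLpLinAlgEquiv 2 (Matrix.diagonal d) (wordVec 𝕜 w) = d w • wordVec 𝕜 w := by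
  ext v
  simp [wordVec, Pi.single_apply]

theorem weightOp_wordVec (hq : 0 < q) (c : Fin n → ℝ) (w : Fin N → Fin n) :
    weightOp 𝕜 N q c (wordVec 𝕜 w) = ((q ^ ∑ l, c (w l) : ℝ) : 𝕜) • wordVec 𝕜 w := by
  rw [weightOp_eq_diagonal hq, toLpLinAlgEquiv_diagonal_wordVec]

variable (hn : 2 ≤ n)

theorem weightOp_mul_coproductOp (hq : 0 < q) (c : Fin n → ℝ) (a b : Fin n) :
    weightOp 𝕜 N q c * coproductOp hn N q (Matrix.single a b 1) =
      ((q ^ (c a - c b) : ℝ) : 𝕜) •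
        (coproductOp hn N q (Matrix.single a b 1) * weightOp 𝕜 N q c) := by
  have site (j : Fin N) : (tensorMatrix fun _ => qDiag 𝕜 q c) *
      siteMatrix hn q (Matrix.single a b 1) j = ((q ^ (c a - c b) : ℝ) : 𝕜) •
        (siteMatrix hn q (Matrix.single a b 1) j * tensorMatrix fun _ => qDiag 𝕜 q c) := by
    have local_factor (l : Fin N) : qDiag 𝕜 q c *
        (if l < j then qDiag 𝕜 q (fun a => -(sDiag hn a) / 2)
          else if l = j then Matrix.single a b 1 else qDiag 𝕜 q (fun a => sDiag hn a / 2)) =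
        (if l = j then ((q ^ (c a - c b) : ℝ) : 𝕜) else 1) •
          ((if l < j then qDiag 𝕜 q (fun a => -(sDiag hn a) / 2)
            else if l = j then Matrix.single a b 1 else qDiag 𝕜 q (fun a => sDiag hn a / 2)) *
          qDiag 𝕜 q c) := by
      rcases lt_trichotomy l j with h | rfl | h
      · simp only [h, h.ne, if_true, if_false, qDiag_mul_qDiag hq, add_comm c, one_smul]
      · simp only [lt_irrefl, if_true, if_false, qDiag_mul_single hq]
      · simp only [h.not_gt, h.ne', if_false, qDiag_mul_qDiag hq, add_comm c, one_smul]
    simp only [siteMatrix, tensorMatrix_mul, local_factor, tensorMatrix_smul, Finset.prod_ite_eq',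
      Finset.mem_univ, if_true]
  rw [coproductOp_eq_toLpLinAlgEquiv, show weightOp 𝕜 N q c =
    Matrix.toLpLinAlgEquiv 2 (tensorMatrix fun _ => qDiag 𝕜 q c) from rfl, ← map_mul, ← map_mul,
    ← map_smul, coproductMatrix, Finset.mul_sum, Finset.sum_mul, Finset.smul_sum]
  simp only [site]

theorem commutator_F₁_E₁ (hq : 0 < q) : F₁ 𝕜 hn N q * E₁ 𝕜 hn N q - E₁ 𝕜 hn N q * F₁ 𝕜 hn N q =
    Matrix.toLpLinAlgEquiv 2
      (Matrix.diagonal fun w => ((qNum q (∑ l, sDiag hn (w l)) : ℝ) : 𝕜)) := by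
  rw [F₁, E₁, coproductOp_eq_toLpLinAlgEquiv, coproductOp_eq_toLpLinAlgEquiv, ← map_mul,
    ← map_mul, ← map_sub, commutator_coproductMatrix hn hq]

theorem commutator_F₁_E₁_wordVec (hq : 0 < q) (w : Fin N → Fin n) :
    (F₁ 𝕜 hn N q * E₁ 𝕜 hn N q - E₁ 𝕜 hn N q * F₁ 𝕜 hn N q) (wordVec 𝕜 w) =
      ((qNum q (∑ l, sDiag hn (w l)) : ℝ) : 𝕜) • wordVec 𝕜 w := by
  rw [commutator_F₁_E₁ hn hq, toLpLinAlgEquiv_diagonal_wordVec]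

theorem commutator_F₁_E₁_eq_weightOp (hq : 0 < q) (hq1 : q ≠ 1) :
    F₁ 𝕜 hn N q * E₁ 𝕜 hn N q - E₁ 𝕜 hn N q * F₁ 𝕜 hn N q =
      (((q - q⁻¹)⁻¹ : ℝ) : 𝕜) • (weightOp 𝕜 N q (sDiag hn) - weightOp 𝕜 N q (-sDiag hn)) := by
  simp only [commutator_F₁_E₁ hn hq, weightOp_eq_diagonal hq, ← map_sub, ← map_smul,
    Matrix.diagonal_sub, ← Matrix.diagonal_smul, Pi.smul_def, Pi.neg_apply, Finset.sum_neg_distrib,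
    ← mul_qNum hq hq1, smul_eq_mul, ← RCLike.ofReal_mul,
    inv_mul_cancel_left₀ (sub_inv_ne_zero hq hq1)]

theorem adjoint_E₁ : LinearMap.adjoint (E₁ 𝕜 hn N q) = F₁ 𝕜 hn N q := by
  rw [E₁, F₁, coproductOp_eq_toLpLinAlgEquiv, coproductOp_eq_toLpLinAlgEquiv]
  refine (Matrix.toEuclideanLin_conjTranspose_eq_adjoint _).symm.trans ?_
  rw [conjTranspose_coproductMatrix, Matrix.conjTranspose_single, star_one]
  rfl

end WeightOp

section PairMatrix

variable {𝕜 : Type*} [RCLike 𝕜] {n N : ℕ} {i j : Fin N}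

/-- Splits a word into its letters at the positions `i, j` and the remaining word. -/
def splitPair {ι α : Type*} (i j : ι) (w : ι → α) : (α × α) × ({l // l ≠ i ∧ l ≠ j} → α) :=
  ((w i, w j), fun l => w l)

theorem splitPair_bijective {ι α : Type*} {i j : ι} (hij : i ≠ j) :
    Function.Bijective (splitPair i j : (ι → α) → _) := by
  classical
  constructor
  · intro w w' h
    simp only [splitPair, Prod.mk.injEq, funext_iff, Subtype.forall] at h
    funext l
    by_cases hl : l ≠ i ∧ l ≠ j
    · exact h.2 l hl
    · rcases not_and_or.1 hl with hl | hl <;> rw [not_not.1 hl]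
      exacts [h.1.1, h.1.2]
  · rintro ⟨⟨a, b⟩, u⟩
    refine ⟨fun l => if h : l ≠ i ∧ l ≠ j then u ⟨l, h⟩ else if l = i then a else b, ?_⟩
    refine Prod.ext (Prod.ext ?_ ?_) (funext fun l => ?_)
    · simp [splitPair]
    · simp [splitPair, hij.symm]
    · exact dif_pos l.2

/-- The matrix of the operator that acts by `M` on the tensor factors `i, j` and by `C l` on every
other factor `l`. -/
def pairMatrix {ι α R : Type*} [Fintype ι] [DecidableEq ι] [CommSemiring R] (i j : ι)
    (M : Matrix (α × α) (α × α) R) (C : ι → Matrix α α R) : Matrix (ι → α) (ι → α) R :=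
  (M ⊗ₖ tensorMatrix fun l : {l // l ≠ i ∧ l ≠ j} => C l).submatrix (splitPair i j) (splitPair i j)

section

variable {ι α R : Type*} [Fintype ι] [DecidableEq ι] [CommSemiring R] {i j : ι}

theorem pairMatrix_mul [Fintype α] (hij : i ≠ j) (M M' : Matrix (α × α) (α × α) R)
    (C C' : ι → Matrix α α R) :
    pairMatrix i j M C * pairMatrix i j M' C' = pairMatrix i j (M * M') fun l => C l * C' l := by
  rw [pairMatrix, pairMatrix, ← Matrix.submatrix_mul _ _ _ _ _ (splitPair_bijective hij),
    ← Matrix.mul_kronecker_mul, tensorMatrix_mul, pairMatrix]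

theorem pairMatrix_add (M M' : Matrix (α × α) (α × α) R) (C : ι → Matrix α α R) :
    pairMatrix i j (M + M') C = pairMatrix i j M C + pairMatrix i j M' C := by
  rw [pairMatrix, Matrix.add_kronecker, Matrix.submatrix_add]
  rfl

theorem pairMatrix_congr {C C' : ι → Matrix α α R} (h : ∀ l, l ≠ i → l ≠ j → C l = C' l)
    (M : Matrix (α × α) (α × α) R) : pairMatrix i j M C = pairMatrix i j M C' := by
  rw [pairMatrix, pairMatrix]
  congr 3
  exact funext fun l => h l l.2.1 l.2.2

theorem tensorMatrix_eq_pairMatrix (hij : i ≠ j) (C : ι → Matrix α α R) :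
    tensorMatrix C = pairMatrix i j (C i ⊗ₖ C j) C := by
  ext w w'
  simp only [tensorMatrix, pairMatrix, splitPair, Matrix.of_apply, Matrix.submatrix_apply,
    Matrix.kroneckerMap_apply]
  rw [← Finset.prod_mul_prod_compl {i, j}, Finset.prod_pair hij,
    Finset.prod_subtype (p := fun l => l ≠ i ∧ l ≠ j) _ (by simp)]

end

theorem twoSite_eq_pairMatrix (M : Matrix (Fin n × Fin n) (Fin n × Fin n) 𝕜) :
    twoSite M i j = pairMatrix i j M fun _ => 1 := by
  ext w w'
  have h : (tensorMatrix fun _ : {l // l ≠ i ∧ l ≠ j} => (1 : Matrix (Fin n) (Fin n) 𝕜)) = 1 := by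
    simp only [← Matrix.diagonal_one, tensorMatrix_diagonal, Finset.prod_const_one]
  simp only [twoSite, pairMatrix, splitPair, h, Matrix.submatrix_apply, Matrix.kroneckerMap_apply,
    Matrix.one_apply, funext_iff, Subtype.forall, and_imp, mul_ite, mul_one, mul_zero]

theorem commute_twoSite_pairMatrix (hij : i ≠ j) {M M' : Matrix (Fin n × Fin n) (Fin n × Fin n) 𝕜}
    (h : Commute M M') (C : Fin N → Matrix (Fin n) (Fin n) 𝕜) :
    Commute (twoSite M i j) (pairMatrix i j M' C) := by
  rw [twoSite_eq_pairMatrix, Commute, SemiconjBy, pairMatrix_mul hij, pairMatrix_mul hij, h.eq]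
  simp only [one_mul, mul_one]

theorem conjTranspose_twoSite (M : Matrix (Fin n × Fin n) (Fin n × Fin n) 𝕜) :
    (twoSite M i j).conjTranspose = twoSite M.conjTranspose i j := by
  ext w w'
  simp only [twoSite, Matrix.conjTranspose_apply, apply_ite star, star_zero, eq_comm]

/-- The image `X ⊗ q^(s_1/2) + q^(-s_1/2) ⊗ X` of a Chevalley generator under the coproduct: the
case `N = 2` of `coproductOp`. -/
noncomputable def coproduct₂ (hn : 2 ≤ n) (q : ℝ) (X : Matrix (Fin n) (Fin n) 𝕜) :
    Matrix (Fin n × Fin n) (Fin n × Fin n) 𝕜 :=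
  X ⊗ₖ qDiag 𝕜 q (fun a => sDiag hn a / 2) + qDiag 𝕜 q (fun a => -(sDiag hn a) / 2) ⊗ₖ X

/-- Only the two summands with `X` at `i` or `j` see more of `M` than the factors `q^{±s_1/2}`, and
together they act on these two positions by the coproduct of `X`. -/
theorem commute_twoSite_coproductMatrix (hn : 2 ≤ n) {q : ℝ} (hij : i.1 + 1 = j.1)
    {M : Matrix (Fin n × Fin n) (Fin n × Fin n) 𝕜} {X : Matrix (Fin n) (Fin n) 𝕜}
    (hK : ∀ c : Fin n → ℝ, Commute M (qDiag 𝕜 q c ⊗ₖ qDiag 𝕜 q c))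
    (hX : Commute M (coproduct₂ hn q X)) :
    Commute (twoSite M i j) (coproductMatrix hn N q X) := by
  have hlt : i < j := by omega
  have away (l : Fin N) (hi : l ≠ i) (hj : l ≠ j) :
      Commute (twoSite M i j) (siteMatrix hn q X l) := by
    rw [siteMatrix, tensorMatrix_eq_pairMatrix hlt.ne]
    refine commute_twoSite_pairMatrix hlt.ne ?_ _
    rcases hi.lt_or_gt with h | h
    · simp only [h.not_gt, (h.trans hlt).not_gt, hi.symm, hj.symm, if_false, hK]
    · have h' : j < l := by omega
      simp only [h, h', if_true, hK]
  have near : siteMatrix hn q X i + siteMatrix hn q X j =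
      pairMatrix i j (coproduct₂ hn q X) fun l =>
        if l < i then qDiag 𝕜 q (fun a => -(sDiag hn a) / 2)
        else if l = i then X else qDiag 𝕜 q (fun a => sDiag hn a / 2) := by
    rw [siteMatrix, siteMatrix, tensorMatrix_eq_pairMatrix hlt.ne,
      tensorMatrix_eq_pairMatrix hlt.ne, coproduct₂, pairMatrix_add]
    simp only [lt_irrefl, hlt.not_gt, hlt.ne', hlt, if_true, if_false]
    refine congrArg _ (pairMatrix_congr (fun l hi hj => ?_) _)
    have : l < j ↔ l < i := by omega
    simp only [this, hi, hj, if_false]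
  rw [coproductMatrix, ← Finset.sum_add_sum_compl {i, j}, Finset.sum_pair hlt.ne, near]
  refine (commute_twoSite_pairMatrix hlt.ne hX _).add_right (Commute.sum_right _ _ _ fun l hl => ?_)
  simp only [Finset.mem_compl, Finset.mem_insert, Finset.mem_singleton, not_or] at hl
  exact away l hl.1 hl.2

end PairMatrix

section BraidMatrix

open scoped Matrix

variable {𝕜 : Type*} [RCLike 𝕜] {n : ℕ} {q : ℝ}

theorem isHermitian_rMatrix : (rMatrix 𝕜 n q).IsHermitian := by
  rw [Matrix.IsHermitian, rMatrix]
  simp only [Matrix.conjTranspose_add, Matrix.conjTranspose_smul, Matrix.conjTranspose_sum,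
    Matrix.conjTranspose_kronecker, Matrix.conjTranspose_single, star_one, RCLike.star_def,
    RCLike.conj_ofReal, apply_ite Matrix.conjTranspose, Matrix.conjTranspose_zero]
  congr 3
  rw [Finset.sum_comm]
  simp only [ne_comm]

theorem commute_single_kronecker_single (hq : 0 < q) (t : Fin n → ℝ) {a b c d : Fin n}
    (h : t b + t d = t a + t c) :
    Commute (Matrix.single a b (1 : 𝕜) ⊗ₖ Matrix.single c d 1) (qDiag 𝕜 q t ⊗ₖ qDiag 𝕜 q t) := by
  rw [Commute, SemiconjBy, ← Matrix.mul_kronecker_mul, ← Matrix.mul_kronecker_mul,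
    single_mul_qDiag hq, single_mul_qDiag hq, Matrix.smul_kronecker, Matrix.kronecker_smul,
    smul_smul, ← RCLike.ofReal_mul, ← Real.rpow_add hq,
    show t b - t a + (t d - t c) = 0 by linarith, Real.rpow_zero, RCLike.ofReal_one, one_smul]

theorem commute_rMatrix_qDiag (hq : 0 < q) (t : Fin n → ℝ) :
    Commute (rMatrix 𝕜 n q) (qDiag 𝕜 q t ⊗ₖ qDiag 𝕜 q t) := by
  refine .add_left (.add_left (.sum_left _ _ _ fun a _ => ?_)
    (.smul_left (.sum_left _ _ _ fun a _ => .sum_left _ _ _ fun b _ => ?_) _))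
    (.smul_left (.sum_left _ _ _ fun a _ => .sum_left _ _ _ fun b _ => ?_) _)
  · exact commute_single_kronecker_single hq t rfl
  · split_ifs
    · exact commute_single_kronecker_single hq t (add_comm _ _)
    · exact .zero_left _
  · split_ifs
    · exact commute_single_kronecker_single hq t rfl
    · exact .zero_left _

/-- The basis vector `x_a ⊗ x_b` of `𝕜^n ⊗ 𝕜^n`. -/
def pairVec (𝕜 : Type*) [RCLike 𝕜] {n : ℕ} (a b : Fin n) : Fin n × Fin n → 𝕜 :=
  Pi.single (a, b) 1

theorem single_kronecker_single_mulVec (a b c d x y : Fin n) :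
    (Matrix.single a b (1 : 𝕜) ⊗ₖ Matrix.single c d 1) *ᵥ pairVec 𝕜 x y =
      if b = x ∧ d = y then pairVec 𝕜 a c else 0 := by
  rw [Matrix.single_kronecker_single, Matrix.single_mulVec_eq, pairVec, pairVec, Pi.single_apply]
  simp only [Prod.mk.injEq, mul_one, mul_ite, mul_zero, ite_smul, one_smul, zero_smul]

theorem sum_sum_ite_and_eq {ι M : Type*} [Fintype ι] [DecidableEq ι] [AddCommMonoid M]
    (P : ι → ι → Prop) [∀ a b, Decidable (P a b)] (v : ι → ι → M) (x y : ι) :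
    (∑ a, ∑ b, if P a b then (if a = x ∧ b = y then v a b else 0) else 0) =
      if P x y then v x y else 0 := by
  rw [Fintype.sum_eq_single x fun a ha => by simp [ha],
    Fintype.sum_eq_single y fun b hb => by simp [hb]]
  simp only [true_and, if_true]

theorem rMatrix_mulVec (a b : Fin n) : rMatrix 𝕜 n q *ᵥ pairVec 𝕜 a b =
    (if a = b then pairVec 𝕜 a b else ((q⁻¹ : ℝ) : 𝕜) • pairVec 𝕜 b a) +
      if b < a then ((1 - (q ^ 2)⁻¹ : ℝ) : 𝕜) • pairVec 𝕜 a b else 0 := by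
  have diag : (∑ c, if c = a ∧ c = b then pairVec 𝕜 c c else 0) =
      if a = b then pairVec 𝕜 a b else 0 := by
    rw [Fintype.sum_eq_single a fun c hc => if_neg fun h => hc h.1]
    split_ifs <;> simp_all
  simp only [rMatrix, Matrix.add_mulVec, Matrix.smul_mulVec, Matrix.sum_mulVec,
    apply_ite (· *ᵥ pairVec 𝕜 a b), Matrix.zero_mulVec, single_kronecker_single_mulVec, diag]
  rw [sum_sum_ite_and_eq (fun a b => b < a), Finset.sum_comm,
    sum_sum_ite_and_eq (fun a b => b ≠ a) (fun a b => pairVec 𝕜 b a), smul_ite, smul_ite,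
    smul_zero, smul_zero]
  congr 1
  by_cases h : a = b
  · simp only [h, ne_eq, not_true_eq_false, if_true, if_false, add_zero]
  · simp only [h, Ne.symm h, ne_eq, not_false_eq_true, if_true, if_false, zero_add]

theorem rMatrix_mulVec_self (a : Fin n) : rMatrix 𝕜 n q *ᵥ pairVec 𝕜 a a = pairVec 𝕜 a a := by
  rw [rMatrix_mulVec, if_pos rfl, if_neg (lt_irrefl a), add_zero]

theorem rMatrix_mulVec_of_lt {a b : Fin n} (h : a < b) :
    rMatrix 𝕜 n q *ᵥ pairVec 𝕜 a b = ((q⁻¹ : ℝ) : 𝕜) • pairVec 𝕜 b a := by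
  rw [rMatrix_mulVec, if_neg h.ne, if_neg h.not_gt, add_zero]

theorem rMatrix_mulVec_of_gt {a b : Fin n} (h : b < a) : rMatrix 𝕜 n q *ᵥ pairVec 𝕜 a b =
    ((q⁻¹ : ℝ) : 𝕜) • pairVec 𝕜 b a + ((1 - (q ^ 2)⁻¹ : ℝ) : 𝕜) • pairVec 𝕜 a b := by
  rw [rMatrix_mulVec, if_neg h.ne', if_pos h]

theorem kronecker_mulVec_pairVec (A B : Matrix (Fin n) (Fin n) 𝕜) (a b : Fin n) :
    (A ⊗ₖ B) *ᵥ pairVec 𝕜 a b = fun p => A p.1 a * B p.2 b :=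
  Matrix.mulVec_single_one _ _

theorem ext_of_mulVec_pairVec {A B : Matrix (Fin n × Fin n) (Fin n × Fin n) 𝕜}
    (h : ∀ a b, A *ᵥ pairVec 𝕜 a b = B *ᵥ pairVec 𝕜 a b) : A = B :=
  Matrix.ext_of_mulVec_single fun ⟨a, b⟩ => h a b

theorem coproduct₂_single_mulVec {p : ℝ} (hp : 0 < p) {hn : 2 ≤ n} (a b : Fin n) :
    coproduct₂ hn (p ^ 2) (Matrix.single (x₂ hn) (x₁ hn) (1 : 𝕜)) *ᵥ pairVec 𝕜 a b =
      (if a = x₁ hn then ((p ^ sDiag hn b : ℝ) : 𝕜) • pairVec 𝕜 (x₂ hn) b else 0) +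
        if b = x₁ hn then ((p ^ (-sDiag hn a) : ℝ) : 𝕜) • pairVec 𝕜 a (x₂ hn) else 0 := by
  have sqrt_pow (t : ℝ) : ((p ^ 2) ^ (t / 2) : ℝ) = p ^ t := by
    rw [← Real.rpow_natCast_mul hp.le, Nat.cast_two, mul_div_cancel₀ t two_ne_zero]
  rw [coproduct₂, Matrix.add_mulVec, kronecker_mulVec_pairVec, kronecker_mulVec_pairVec]
  congr 1 <;> ext ⟨c, d⟩ <;>
    simp only [qDiag, pairVec, Matrix.single_apply, Matrix.diagonal_apply, ite_apply, Pi.zero_apply,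
      Pi.smul_apply, Pi.single_apply, Prod.mk.injEq, smul_eq_mul, sqrt_pow] <;>
    grind

section

variable {p : ℝ} (hp : 0 < p) (hn : 2 ≤ n)

include hp

theorem rMatrix_mulVec_coproduct₂_x₁_x₁ : rMatrix 𝕜 n (p ^ 2) *ᵥ
      (coproduct₂ hn (p ^ 2) (Matrix.single (x₂ hn) (x₁ hn) (1 : 𝕜)) *ᵥ
        pairVec 𝕜 (x₁ hn) (x₁ hn)) =
    coproduct₂ hn (p ^ 2) (Matrix.single (x₂ hn) (x₁ hn) 1) *ᵥ
      (rMatrix 𝕜 n (p ^ 2) *ᵥ pairVec 𝕜 (x₁ hn) (x₁ hn)) := by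
  have hp' : (p : 𝕜) ≠ 0 := RCLike.ofReal_ne_zero.2 hp.ne'
  have h12 := x₁_lt_x₂ hn
  simp only [coproduct₂_single_mulVec hp, rMatrix_mulVec_self, rMatrix_mulVec_of_lt h12,
    rMatrix_mulVec_of_gt h12, Matrix.mulVec_add, Matrix.mulVec_smul, sDiag_x₁, if_true,
    Real.rpow_neg_one, Real.rpow_one]
  match_scalars <;> field_simp
  ring

theorem rMatrix_mulVec_coproduct₂_x₁_left {b : Fin n} (hb : b ≠ x₁ hn) : rMatrix 𝕜 n (p ^ 2) *ᵥ
      (coproduct₂ hn (p ^ 2) (Matrix.single (x₂ hn) (x₁ hn) (1 : 𝕜)) *ᵥ pairVec 𝕜 (x₁ hn) b) =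
    coproduct₂ hn (p ^ 2) (Matrix.single (x₂ hn) (x₁ hn) 1) *ᵥ
      (rMatrix 𝕜 n (p ^ 2) *ᵥ pairVec 𝕜 (x₁ hn) b) := by
  have hp' : (p : 𝕜) ≠ 0 := RCLike.ofReal_ne_zero.2 hp.ne'
  have h12 := x₁_lt_x₂ hn
  rcases eq_or_ne b (x₂ hn) with rfl | hb₂
  · simp only [coproduct₂_single_mulVec hp, rMatrix_mulVec_self, rMatrix_mulVec_of_lt h12, hb,
      Matrix.mulVec_smul, sDiag_x₂, if_true, if_false, Real.rpow_neg_one,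
      Real.rpow_one, neg_neg, add_zero, zero_add]
    match_scalars
    field_simp
  · have h2b := x₂_lt_of_ne hn hb hb₂
    simp only [coproduct₂_single_mulVec hp, rMatrix_mulVec_of_lt h2b,
      rMatrix_mulVec_of_lt (h12.trans h2b), hb, sDiag_of_ne hn hb hb₂, Matrix.mulVec_smul,
      if_true, if_false, neg_zero, Real.rpow_zero, RCLike.ofReal_one, one_smul, add_zero,
      zero_add]

theorem rMatrix_mulVec_coproduct₂_x₁_right {a : Fin n} (ha : a ≠ x₁ hn) : rMatrix 𝕜 n (p ^ 2) *ᵥ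
      (coproduct₂ hn (p ^ 2) (Matrix.single (x₂ hn) (x₁ hn) (1 : 𝕜)) *ᵥ pairVec 𝕜 a (x₁ hn)) =
    coproduct₂ hn (p ^ 2) (Matrix.single (x₂ hn) (x₁ hn) 1) *ᵥ
      (rMatrix 𝕜 n (p ^ 2) *ᵥ pairVec 𝕜 a (x₁ hn)) := by
  have hp' : (p : 𝕜) ≠ 0 := RCLike.ofReal_ne_zero.2 hp.ne'
  have h12 := x₁_lt_x₂ hn
  rcases eq_or_ne a (x₂ hn) with rfl | ha₂
  · simp only [coproduct₂_single_mulVec hp, rMatrix_mulVec_self, rMatrix_mulVec_of_gt h12, ha,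
      Matrix.mulVec_add, Matrix.mulVec_smul, sDiag_x₂, if_true, if_false, Real.rpow_neg_one,
      Real.rpow_one, neg_neg, add_zero, zero_add]
    match_scalars
    field_simp
    ring
  · have h2a := x₂_lt_of_ne hn ha ha₂
    simp only [coproduct₂_single_mulVec hp, rMatrix_mulVec_of_gt h2a,
      rMatrix_mulVec_of_gt (h12.trans h2a), ha, sDiag_of_ne hn ha ha₂, Matrix.mulVec_add,
      Matrix.mulVec_smul, if_true, if_false, neg_zero, Real.rpow_zero, RCLike.ofReal_one,
      one_smul, add_zero, zero_add]

end

theorem commute_rMatrix_coproduct₂ (hn : 2 ≤ n) (hq : 0 < q) :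
    Commute (rMatrix 𝕜 n q) (coproduct₂ hn q (Matrix.single (x₂ hn) (x₁ hn) 1)) := by
  obtain ⟨p, hp, rfl⟩ : ∃ p : ℝ, 0 < p ∧ p ^ 2 = q := ⟨√q, Real.sqrt_pos.2 hq, Real.sq_sqrt hq.le⟩
  refine ext_of_mulVec_pairVec fun a b => ?_
  rw [← Matrix.mulVec_mulVec, ← Matrix.mulVec_mulVec]
  rcases eq_or_ne a (x₁ hn) with rfl | ha <;> rcases eq_or_ne b (x₁ hn) with rfl | hb
  · exact rMatrix_mulVec_coproduct₂_x₁_x₁ hp hn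
  · exact rMatrix_mulVec_coproduct₂_x₁_left hp hn hb
  · exact rMatrix_mulVec_coproduct₂_x₁_right hp hn ha
  · rw [rMatrix_mulVec]
    split_ifs <;> simp only [coproduct₂_single_mulVec hp, ha, hb, if_false, Matrix.mulVec_add,
      Matrix.mulVec_smul, Matrix.mulVec_zero, smul_zero, add_zero]

end BraidMatrix

section Hamiltonian

variable {𝕜 : Type*} [RCLike 𝕜] {n N : ℕ} {q : ℝ}

theorem commute_hamiltonian_E₁ (hn : 2 ≤ n) (hq : 0 < q) :
    Commute (hamiltonian 𝕜 n N q) (E₁ 𝕜 hn N q) := by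
  rw [E₁, coproductOp_eq_toLpLinAlgEquiv]
  refine Commute.map (.sum_left _ _ _ fun j _ => ?_) (Matrix.toLpLinAlgEquiv 2)
  exact commute_twoSite_coproductMatrix hn rfl (commute_rMatrix_qDiag hq)
    (commute_rMatrix_coproduct₂ hn hq)

theorem adjoint_hamiltonian :
    LinearMap.adjoint (hamiltonian 𝕜 n N q) = hamiltonian 𝕜 n N q := by
  rw [hamiltonian, ← Matrix.toEuclideanLin_conjTranspose_eq_adjoint, Matrix.conjTranspose_sum]
  simp only [conjTranspose_twoSite, isHermitian_rMatrix.eq]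

theorem commute_hamiltonian_F₁ (hn : 2 ≤ n) (hq : 0 < q) :
    Commute (hamiltonian 𝕜 n N q) (F₁ 𝕜 hn N q) := by
  have h := congrArg LinearMap.adjoint (commute_hamiltonian_E₁ (𝕜 := 𝕜) (N := N) hn hq).eq
  rw [Module.End.mul_eq_comp, Module.End.mul_eq_comp, LinearMap.adjoint_comp,
    LinearMap.adjoint_comp, adjoint_E₁, adjoint_hamiltonian] at h
  exact h.symm

end Hamiltonian

section Krylov

variable {R M : Type*} [CommSemiring R] [AddCommMonoid M] [Module R M]

/-- The Krylov subspace spanned by `b, E b, …, E ^ (d - 1) b`; for `E = E₁` it is the span of the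
orbit of `b`. -/
def krylovSubspace (E : Module.End R M) (b : M) (d : ℕ) : Submodule R M :=
  Submodule.span R (Set.range fun i : Fin d => (E ^ i.1) b)

variable {E : Module.End R M} {b : M} {d : ℕ}

theorem pow_apply_mem_krylovSubspace {i : ℕ} (hi : i < d) : (E ^ i) b ∈ krylovSubspace E b d :=
  Submodule.subset_span ⟨⟨i, hi⟩, rfl⟩

theorem krylovSubspace_le {U : Submodule R M} (h : ∀ i < d, (E ^ i) b ∈ U) :
    krylovSubspace E b d ≤ U :=
  Submodule.span_le.2 (Set.range_subset_iff.2 fun i => h i i.2)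

theorem apply_mem_krylovSubspace (hE : (E ^ d) b = 0) {v : M} (hv : v ∈ krylovSubspace E b d) :
    E v ∈ krylovSubspace E b d := by
  refine krylovSubspace_le (U := (krylovSubspace E b d).comap E) (fun i hi => ?_) hv
  rw [Submodule.mem_comap, ← Module.End.mul_apply, ← pow_succ']
  rcases Nat.lt_or_eq_of_le (Nat.succ_le_of_lt hi) with h | h
  · exact pow_apply_mem_krylovSubspace h
  · rw [← Nat.succ_eq_add_one, h, hE]
    exact zero_mem _

theorem krylovSubspace_le_span_singleton_sup_map :
    krylovSubspace E b d ≤ Submodule.span R {b} ⊔ (krylovSubspace E b d).map E := by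
  refine krylovSubspace_le fun i hi => ?_
  cases i with
  | zero => exact Submodule.mem_sup_left (Submodule.mem_span_singleton_self b)
  | succ i =>
    refine Submodule.mem_sup_right ⟨(E ^ i) b, pow_apply_mem_krylovSubspace (by omega), ?_⟩
    rw [pow_succ', Module.End.mul_apply]

end Krylov

/-- The last non-zero vector among `w, F w, F² w, …`. -/
theorem exists_mem_ne_zero_apply_eq_zero {R M : Type*} [Semiring R] [AddCommMonoid M] [Module R M]
    {F : Module.End R M} {W : Submodule R M} (hW : ∀ w ∈ W, F w ∈ W) {w : M} (hw : w ∈ W)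
    (hw0 : w ≠ 0) {d : ℕ} (hd : (F ^ d) w = 0) : ∃ u ∈ W, u ≠ 0 ∧ F u = 0 := by
  induction d with
  | zero => exact absurd hd hw0
  | succ d ih =>
    by_cases h : (F ^ d) w = 0
    · exact ih h
    · refine ⟨(F ^ d) w, Module.End.pow_apply_mem_of_forall_mem d hW w hw, h, ?_⟩
      rwa [← Module.End.mul_apply, ← pow_succ']

/-- A unitary `q`-ladder of length `N`: an operator `E` and its adjoint `F` which raise and lower
the index of a sequence of pairwise orthogonal subspaces `S 0, S 1, …`, and whose commutator acts
on `S m` as the `q`-number `[N - 2m]_q`. The spaces `stateSpace` with `E₁` and `F₁` are the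
example of interest; the structure isolates what the representation theory of the orbits uses. -/
structure IsUnitaryLadder {𝕜 H : Type*} [RCLike 𝕜] [NormedAddCommGroup H] [InnerProductSpace 𝕜 H]
    (q : ℝ) (N : ℕ) (E F : Module.End 𝕜 H) (S : ℕ → Submodule 𝕜 H) : Prop where
  inner_raise (v w : H) : inner 𝕜 (E v) w = inner 𝕜 v (F w)
  isOrtho {m m' : ℕ} : m ≠ m' → S m ⟂ S m'
  raise_mem {m : ℕ} {v : H} : v ∈ S m → E v ∈ S (m + 1)
  lower_mem {m : ℕ} {v : H} : v ∈ S (m + 1) → F v ∈ S m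
  commutator_apply {m : ℕ} {v : H} :
    v ∈ S m → F (E v) - E (F v) = ((qNum q (N - 2 * m) : ℝ) : 𝕜) • v

namespace IsUnitaryLadder

variable {𝕜 H : Type*} [RCLike 𝕜] [NormedAddCommGroup H] [InnerProductSpace 𝕜 H]
  {q : ℝ} {N k : ℕ} {E F : Module.End 𝕜 H} {S : ℕ → Submodule 𝕜 H} {b : H}
  (h : IsUnitaryLadder q N E F S)

include h

theorem eq_zero_of_lower_raise_eq_zero {v : H} (hv : F (E v) = 0) : E v = 0 := by
  rw [← inner_self_eq_zero (𝕜 := 𝕜), h.inner_raise, hv, inner_zero_right]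

theorem pow_raise_mem (hb : b ∈ S k) (i : ℕ) : (E ^ i) b ∈ S (k + i) := by
  induction i with
  | zero => exact hb
  | succ i ih =>
    rw [pow_succ', Module.End.mul_apply]
    exact h.raise_mem ih

theorem inner_pow_raise (hb : b ∈ S k) {i j : ℕ} (hij : i ≠ j) :
    inner 𝕜 ((E ^ i) b) ((E ^ j) b) = 0 :=
  (h.isOrtho (by omega)).inner_eq (h.pow_raise_mem hb i) (h.pow_raise_mem hb j)

theorem lower_pow_raise_succ (hq : 0 < q) (hb : b ∈ S k) (hF : F b = 0) (i : ℕ) :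
    F ((E ^ (i + 1)) b) =
      ((qNum q (i + 1) * qNum q (N - 2 * k - i) : ℝ) : 𝕜) • (E ^ i) b := by
  have recursion (j : ℕ) : F ((E ^ (j + 1)) b) =
      E (F ((E ^ j) b)) + ((qNum q (N - 2 * (k + j)) : ℝ) : 𝕜) • (E ^ j) b := by
    rw [pow_succ', Module.End.mul_apply, ← sub_eq_iff_eq_add',
      h.commutator_apply (h.pow_raise_mem hb j), Nat.cast_add]
  induction i with
  | zero => simpa [hF, qNum_one_right hq] using recursion 0
  | succ i ih =>
    have hnum := qNum_mul_add hq (i + 1) (N - 2 * k - (i + 1))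
    rw [recursion, ih, map_smul, ← Module.End.mul_apply, ← pow_succ', ← add_smul,
      ← RCLike.ofReal_add, Nat.cast_add_one, ← hnum]
    ring_nf

theorem pow_raise_ne_zero (hq : 0 < q) (hb : b ∈ S k) (hF : F b = 0) (hb0 : b ≠ 0) {i : ℕ}
    (hi : 2 * k + i ≤ N) : (E ^ i) b ≠ 0 := by
  induction i with
  | zero => exact hb0
  | succ i ih =>
    intro h0
    have hN : (2 * k + (i + 1) : ℝ) ≤ N := by exact_mod_cast hi
    have hc : 0 < qNum q (i + 1) * qNum q (N - 2 * k - i) :=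
      mul_pos (qNum_pos hq (by positivity)) (qNum_pos hq (by linarith))
    refine smul_ne_zero (RCLike.ofReal_ne_zero (K := 𝕜).2 hc.ne') (ih (by omega)) ?_
    rw [← h.lower_pow_raise_succ hq hb hF, h0, map_zero]

theorem pow_raise_eq_zero (hq : 0 < q) (hk : 2 * k ≤ N) (hb : b ∈ S k) (hF : F b = 0) :
    (E ^ (N - 2 * k + 1)) b = 0 := by
  have hFE := h.lower_pow_raise_succ hq hb hF (N - 2 * k)
  rw [Nat.cast_sub hk, Nat.cast_mul, Nat.cast_two, sub_self, qNum_zero, mul_zero,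
    RCLike.ofReal_zero, zero_smul] at hFE
  rw [pow_succ', Module.End.mul_apply] at hFE ⊢
  exact h.eq_zero_of_lower_raise_eq_zero hFE

theorem linearIndependent_pow_raise (hq : 0 < q) (hk : 2 * k ≤ N) (hb : b ∈ S k) (hF : F b = 0)
    (hb0 : b ≠ 0) : LinearIndependent 𝕜 fun i : Fin (N - 2 * k + 1) => (E ^ i.1) b :=
  linearIndependent_of_ne_zero_of_inner_eq_zero
    (fun i => h.pow_raise_ne_zero hq hb hF hb0 (by omega))
    fun _ _ hij => h.inner_pow_raise hb (Fin.val_injective.ne hij)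

theorem lower_mem_krylovSubspace (hq : 0 < q) (hb : b ∈ S k) (hF : F b = 0) {d : ℕ} {v : H}
    (hv : v ∈ krylovSubspace E b d) : F v ∈ krylovSubspace E b d := by
  refine krylovSubspace_le (U := (krylovSubspace E b d).comap F) (fun i hi => ?_) hv
  rw [Submodule.mem_comap]
  cases i with
  | zero => exact hF ▸ zero_mem _
  | succ i =>
    rw [h.lower_pow_raise_succ hq hb hF]
    exact Submodule.smul_mem _ _ (pow_apply_mem_krylovSubspace (by omega))

theorem pow_lower_pow_raise_eq_zero (hq : 0 < q) (hb : b ∈ S k) (hF : F b = 0) (i : ℕ) :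
    (F ^ (i + 1)) ((E ^ i) b) = 0 := by
  induction i with
  | zero => exact hF
  | succ i ih =>
    rw [pow_succ, Module.End.mul_apply, h.lower_pow_raise_succ hq hb hF, map_smul, ih, smul_zero]

theorem pow_lower_eq_zero_of_mem_krylovSubspace (hq : 0 < q) (hb : b ∈ S k) (hF : F b = 0)
    {d : ℕ} {v : H} (hv : v ∈ krylovSubspace E b d) : (F ^ d) v = 0 := by
  refine krylovSubspace_le (U := LinearMap.ker (F ^ d)) (fun i hi => ?_) hv
  obtain ⟨j, rfl⟩ := Nat.exists_eq_add_of_lt hi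
  rw [LinearMap.mem_ker, show i + j + 1 = j + (i + 1) by omega, pow_add, Module.End.mul_apply,
    h.pow_lower_pow_raise_eq_zero hq hb hF, map_zero]

/-- Write `u = c • b + E v`; then `E v` is killed by `F`, so `E v = 0`. -/
theorem mem_span_singleton_of_lower_eq_zero (hF : F b = 0) {d : ℕ} {u : H}
    (hu : u ∈ krylovSubspace E b d) (hFu : F u = 0) : u ∈ Submodule.span 𝕜 {b} := by
  obtain ⟨_, hx, _, ⟨v, -, rfl⟩, rfl⟩ :=
    Submodule.mem_sup.1 (krylovSubspace_le_span_singleton_sup_map hu)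
  obtain ⟨c, rfl⟩ := Submodule.mem_span_singleton.1 hx
  rw [map_add, map_smul, hF, smul_zero, zero_add] at hFu
  rwa [h.eq_zero_of_lower_raise_eq_zero hFu, add_zero]

theorem eq_bot_or_eq_krylovSubspace (hq : 0 < q) (hb : b ∈ S k) (hF : F b = 0) {d : ℕ}
    {W : Submodule 𝕜 H} (hWV : W ≤ krylovSubspace E b d) (hE : ∀ w ∈ W, E w ∈ W)
    (hW : ∀ w ∈ W, F w ∈ W) : W = ⊥ ∨ W = krylovSubspace E b d := by
  refine or_iff_not_imp_left.2 fun hbot => le_antisymm hWV ?_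
  obtain ⟨w, hw, hw0⟩ := Submodule.exists_mem_ne_zero_of_ne_bot hbot
  obtain ⟨u, hu, hu0, hFu⟩ := exists_mem_ne_zero_apply_eq_zero hW hw hw0
    (h.pow_lower_eq_zero_of_mem_krylovSubspace hq hb hF (hWV hw))
  obtain ⟨c, rfl⟩ := Submodule.mem_span_singleton.1
    (h.mem_span_singleton_of_lower_eq_zero hF (hWV hu) hFu)
  have hbW : b ∈ W := (Submodule.smul_mem_iff _ (left_ne_zero_of_smul hu0)).1 hu
  exact krylovSubspace_le fun i _ => Module.End.pow_apply_mem_of_forall_mem i hE b hbW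

end IsUnitaryLadder

section RealEigenvalues

variable {𝕜 M : Type*} [RCLike 𝕜] [AddCommGroup M] [Module 𝕜 M]

/-- The real eigenvalues of `T` that have an eigenvector in `U`; `eigenvalues` and
`sectorEigenvalues` are of this form. -/
def realEigenvalues (T : Module.End 𝕜 M) (U : Submodule 𝕜 M) : Set ℝ :=
  {Λ | ∃ b ∈ U, b ≠ 0 ∧ T b = (Λ : 𝕜) • b}

variable {T : Module.End 𝕜 M} {U : Submodule 𝕜 M}

theorem exists_linearIndependent_realEigenvalues (T : Module.End 𝕜 M) (U : Submodule 𝕜 M) :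
    ∃ x : realEigenvalues T U → U, LinearIndependent 𝕜 x := by
  choose x hxU hx0 hx using fun Λ : realEigenvalues T U => Λ.2
  refine ⟨fun Λ => ⟨x Λ, hxU Λ⟩, .of_comp U.subtype ?_⟩
  exact Module.End.eigenvectors_linearIndependent' T (fun Λ : realEigenvalues T U => ((Λ : ℝ) : 𝕜))
    (RCLike.ofReal_injective.comp Subtype.val_injective) x
    fun Λ => ⟨Module.End.mem_eigenspace_iff.2 (hx Λ), hx0 Λ⟩

variable [FiniteDimensional 𝕜 U]

theorem finite_realEigenvalues : (realEigenvalues T U).Finite :=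
  let ⟨_, hx⟩ := exists_linearIndependent_realEigenvalues T U
  hx.finite_of_isNoetherian

theorem ncard_realEigenvalues_le : (realEigenvalues T U).ncard ≤ Module.finrank 𝕜 U := by
  obtain ⟨x, hx⟩ := exists_linearIndependent_realEigenvalues T U
  have := finite_realEigenvalues (T := T) (U := U).fintype
  rw [← Nat.card_coe_set_eq, Nat.card_eq_fintype_card]
  exact hx.fintype_card_le_finrank

end RealEigenvalues

namespace IsUnitaryLadder

variable {𝕜 H : Type*} [RCLike 𝕜] [NormedAddCommGroup H] [InnerProductSpace 𝕜 H]
  {q : ℝ} {N m : ℕ} {E F : Module.End 𝕜 H} {S : ℕ → Submodule 𝕜 H}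
  (h : IsUnitaryLadder q N E F S)

include h

/-- `‖E v‖² = ‖F v‖² + [N - 2m]_q ‖v‖²`. -/
theorem eq_zero_of_raise_eq_zero (hq : 0 < q) (hm : 2 * m < N) {v : H} (hv : v ∈ S m)
    (hEv : E v = 0) : v = 0 := by
  have hpos : 0 < qNum q (N - 2 * m) := qNum_pos hq (by
    rw [sub_pos]
    exact_mod_cast hm)
  have hsum : ((‖F v‖ ^ 2 + qNum q (N - 2 * m) * ‖v‖ ^ 2 : ℝ) : 𝕜) = 0 := by
    have hinner := congrArg (inner 𝕜 v) (h.commutator_apply hv)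
    rw [hEv, map_zero, zero_sub, inner_neg_right, ← inner_conj_symm, h.inner_raise,
      inner_self_eq_norm_sq_to_K, inner_smul_right, inner_self_eq_norm_sq_to_K, map_pow,
      RCLike.conj_ofReal] at hinner
    push_cast
    rw [← hinner, add_neg_cancel]
  rw [RCLike.ofReal_eq_zero] at hsum
  have hv0 : ‖v‖ ^ 2 = 0 := by nlinarith [sq_nonneg ‖F v‖, sq_nonneg ‖v‖]
  exact norm_eq_zero.1 (pow_eq_zero_iff two_ne_zero |>.1 hv0)

theorem lower_mem_realEigenvalues {T : Module.End 𝕜 H} (hT : Commute T F) {Λ : ℝ} {b : H}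
    (hb : b ∈ S (m + 1)) (hΛ : T b = (Λ : 𝕜) • b) (hF : F b ≠ 0) :
    Λ ∈ realEigenvalues T (S m) := by
  refine ⟨F b, h.lower_mem hb, hF, ?_⟩
  rw [← Module.End.mul_apply, hT.eq, Module.End.mul_apply, hΛ, map_smul]

variable [FiniteDimensional 𝕜 H]

/-- `E` embeds `S m` into `S (m + 1)`, and its range meets the kernel of `F` only in `0`. -/
theorem finrank_inf_ker_lower_add_le (hq : 0 < q) (hm : 2 * m < N) :
    Module.finrank 𝕜 (S (m + 1) ⊓ LinearMap.ker F : Submodule 𝕜 H) + Module.finrank 𝕜 (S m) ≤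
      Module.finrank 𝕜 (S (m + 1)) := by
  have hinj : Function.Injective (E.domRestrict (S m)) := by
    rw [injective_iff_map_eq_zero]
    exact fun v hv => Subtype.ext (h.eq_zero_of_raise_eq_zero hq hm v.2 hv)
  have hdisjoint : (S (m + 1) ⊓ LinearMap.ker F) ⊓ LinearMap.range (E.domRestrict (S m)) = ⊥ := by
    rw [Submodule.eq_bot_iff]
    rintro _ ⟨⟨-, hF⟩, u, rfl⟩
    exact h.eq_zero_of_lower_raise_eq_zero hF
  have hle : (S (m + 1) ⊓ LinearMap.ker F) ⊔ LinearMap.range (E.domRestrict (S m)) ≤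
      S (m + 1) := by
    refine sup_le inf_le_left ?_
    rintro _ ⟨u, rfl⟩
    exact h.raise_mem u.2
  have hsum := Submodule.finrank_sup_add_finrank_inf_eq (S (m + 1) ⊓ LinearMap.ker F)
    (LinearMap.range (E.domRestrict (S m)))
  rw [hdisjoint, finrank_bot, add_zero, LinearMap.finrank_range_of_inj hinj] at hsum
  exact hsum ▸ Submodule.finrank_mono hle

/-- The real eigenvalues of `T` on `S (m + 1)` lie in the union of the two sets below, whose sizes
add up to at most `dim S (m + 1)`. -/
theorem ncard_realEigenvalues_inf_ker_lower {T : Module.End 𝕜 H} (hT : Commute T F) (hq : 0 < q)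
    (hm : 2 * m < N)
    (hd : (realEigenvalues T (S (m + 1))).ncard = Module.finrank 𝕜 (S (m + 1))) :
    (realEigenvalues T (S (m + 1) ⊓ LinearMap.ker F)).ncard + Module.finrank 𝕜 (S m) =
        Module.finrank 𝕜 (S (m + 1)) ∧
      Disjoint (realEigenvalues T (S (m + 1) ⊓ LinearMap.ker F)) (realEigenvalues T (S m)) := by
  have hcover : realEigenvalues T (S (m + 1)) ⊆
      realEigenvalues T (S (m + 1) ⊓ LinearMap.ker F) ∪ realEigenvalues T (S m) := by
    rintro Λ ⟨b, hb, hb0, hΛ⟩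
    by_cases hF : F b = 0
    · exact .inl ⟨b, ⟨hb, hF⟩, hb0, hΛ⟩
    · exact .inr (h.lower_mem_realEigenvalues hT hb hΛ hF)
  have hunion := Set.ncard_le_ncard hcover (finite_realEigenvalues.union finite_realEigenvalues)
  have hinter := Set.ncard_union_add_ncard_inter _ _
    (finite_realEigenvalues (T := T) (U := S (m + 1) ⊓ LinearMap.ker F))
    (finite_realEigenvalues (T := T) (U := S m))
  have hker := ncard_realEigenvalues_le (T := T) (U := S (m + 1) ⊓ LinearMap.ker F)
  have hlow := ncard_realEigenvalues_le (T := T) (U := S m)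
  have hdim := h.finrank_inf_ker_lower_add_le hq hm
  refine ⟨by omega, ?_⟩
  rw [Set.disjoint_iff_inter_eq_empty,
    ← Set.ncard_eq_zero (finite_realEigenvalues.inter_of_left _)]
  omega

end IsUnitaryLadder

section StateSpace

variable {𝕜 : Type*} [RCLike 𝕜] {n N m : ℕ} (hn : 2 ≤ n) {q : ℝ} {v : TensorSpace 𝕜 n N}

theorem wordOf_eq_x₁_iff {S : Finset (Fin N)} {l : Fin N} : wordOf hn S l = x₁ hn ↔ l ∉ S := by
  rw [wordOf]
  split_ifs with h <;> simp [h, (x₁_ne_x₂ hn).symm]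

theorem wordOf_eq_x₂_iff {S : Finset (Fin N)} {l : Fin N} : wordOf hn S l = x₂ hn ↔ l ∈ S := by
  rw [wordOf]
  split_ifs with h <;> simp [h, x₁_ne_x₂ hn]

theorem wordOf_injective : Function.Injective (wordOf hn : Finset (Fin N) → Fin N → Fin n) :=
  fun S T h => Finset.ext fun l => by rw [← wordOf_eq_x₂_iff hn, h, wordOf_eq_x₂_iff hn]

theorem update_wordOf_x₂ (S : Finset (Fin N)) (j : Fin N) :
    Function.update (wordOf hn S) j (x₂ hn) = wordOf hn (insert j S) := by
  ext l
  obtain rfl | h := eq_or_ne l j <;> simp [wordOf, *]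

theorem update_wordOf_x₁ (S : Finset (Fin N)) (j : Fin N) :
    Function.update (wordOf hn S) j (x₁ hn) = wordOf hn (S.erase j) := by
  ext l
  obtain rfl | h := eq_or_ne l j <;> simp [wordOf, *]

theorem sum_comp_wordOf (c : Fin n → ℝ) (S : Finset (Fin N)) :
    ∑ l, c (wordOf hn S l) = (N - S.card) * c (x₁ hn) + S.card * c (x₂ hn) := by
  have split (l : Fin N) : c (wordOf hn S l) =
      c (x₁ hn) + if l ∈ S then c (x₂ hn) - c (x₁ hn) else 0 := by
    rw [wordOf]
    split_ifs <;> ring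
  simp only [split, Finset.sum_add_distrib, Finset.sum_const, Finset.card_univ, Fintype.card_fin,
    Finset.sum_ite_mem, Finset.univ_inter, nsmul_eq_mul]
  ring

theorem stateSpace_le_iff {U : Submodule 𝕜 (TensorSpace 𝕜 n N)} : stateSpace 𝕜 hn N m ≤ U ↔
    ∀ S : Finset (Fin N), S.card = m → wordVec 𝕜 (wordOf hn S) ∈ U := by
  rw [stateSpace, Submodule.span_le]
  exact ⟨fun h S hS => h ⟨S, hS, rfl⟩, by rintro h _ ⟨S, hS, rfl⟩; exact h S hS⟩

theorem mem_stateSpace_of_support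
    (h : ∀ w, v w ≠ 0 → ∃ S : Finset (Fin N), S.card = m ∧ w = wordOf hn S) :
    v ∈ stateSpace 𝕜 hn N m := by
  rw [← (EuclideanSpace.basisFun (Fin N → Fin n) 𝕜).sum_repr v]
  refine Submodule.sum_mem _ fun w _ => ?_
  rw [EuclideanSpace.basisFun_repr, EuclideanSpace.basisFun_apply]
  obtain hw | hw := eq_or_ne (v w) 0
  · simp only [hw, zero_smul, zero_mem]
  · obtain ⟨S, hS, rfl⟩ := h w hw
    exact Submodule.smul_mem _ _ (Submodule.subset_span ⟨S, hS, rfl⟩)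

theorem orthonormal_wordVec : Orthonormal 𝕜 (wordVec 𝕜 : (Fin N → Fin n) → TensorSpace 𝕜 n N) :=
  EuclideanSpace.orthonormal_single

theorem finrank_stateSpace : Module.finrank 𝕜 (stateSpace 𝕜 hn N m) = N.choose m := by
  have range_eq : {v | ∃ S : Finset (Fin N), S.card = m ∧ v = wordVec 𝕜 (wordOf hn S)} =
      Set.range fun S : {S : Finset (Fin N) // S.card = m} => wordVec 𝕜 (wordOf hn S.1) := by
    ext v
    simp [eq_comm]
  rw [stateSpace, range_eq, finrank_span_eq_card, Fintype.card_finset_len, Fintype.card_fin]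
  exact orthonormal_wordVec.linearIndependent.comp _
    ((wordOf_injective hn).comp Subtype.val_injective)

theorem isOrtho_stateSpace {m m' : ℕ} (h : m ≠ m') :
    stateSpace 𝕜 hn N m ⟂ stateSpace 𝕜 hn N m' := by
  refine Submodule.isOrtho_span.2 ?_
  rintro _ ⟨S, rfl, rfl⟩ _ ⟨T, rfl, rfl⟩
  exact orthonormal_wordVec.inner_eq_zero fun hST => h (congrArg _ (wordOf_injective hn hST))

theorem exists_eq_update_of_coproductMatrix_ne_zero {a b : Fin n} {w w' : Fin N → Fin n}
    (h : coproductMatrix hn N q (Matrix.single a b (1 : 𝕜)) w w' ≠ 0) :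
    ∃ j, w' j = b ∧ w = Function.update w' j a := by
  rw [coproductMatrix, Matrix.sum_apply] at h
  obtain ⟨j, -, hj⟩ := Finset.exists_ne_zero_of_sum_ne_zero h
  rw [siteMatrix, tensorMatrix, Matrix.of_apply, Finset.prod_ne_zero_iff] at hj
  have at_j : a = w j ∧ b = w' j := by
    simpa [Matrix.single_apply] using hj j (Finset.mem_univ j)
  refine ⟨j, at_j.2.symm, Function.eq_update_iff.2 ⟨at_j.1.symm, fun l hl => ?_⟩⟩
  by_contra hne
  refine hj l (Finset.mem_univ l) ?_
  split_ifs <;> simp only [qDiag, Matrix.diagonal_apply_ne _ hne]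

theorem coproductOp_wordVec_apply (X : Matrix (Fin n) (Fin n) 𝕜) (w w' : Fin N → Fin n) :
    coproductOp hn N q X (wordVec 𝕜 w) w' = coproductMatrix hn N q X w' w := by
  rw [coproductOp_eq_toLpLinAlgEquiv]
  simp [wordVec]

theorem E₁_mem_stateSpace (hv : v ∈ stateSpace 𝕜 hn N m) :
    E₁ 𝕜 hn N q v ∈ stateSpace 𝕜 hn N (m + 1) := by
  refine (stateSpace_le_iff hn (U := (stateSpace 𝕜 hn N (m + 1)).comap (E₁ 𝕜 hn N q))).2
    (fun S hS => mem_stateSpace_of_support hn fun w hw => ?_) hv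
  rw [E₁, coproductOp_wordVec_apply] at hw
  obtain ⟨j, hj, rfl⟩ := exists_eq_update_of_coproductMatrix_ne_zero hn hw
  rw [wordOf_eq_x₁_iff] at hj
  exact ⟨insert j S, hS ▸ Finset.card_insert_of_notMem hj, update_wordOf_x₂ hn S j⟩

theorem F₁_mem_stateSpace (hv : v ∈ stateSpace 𝕜 hn N (m + 1)) :
    F₁ 𝕜 hn N q v ∈ stateSpace 𝕜 hn N m := by
  refine (stateSpace_le_iff hn (U := (stateSpace 𝕜 hn N m).comap (F₁ 𝕜 hn N q))).2
    (fun S hS => mem_stateSpace_of_support hn fun w hw => ?_) hv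
  rw [F₁, coproductOp_wordVec_apply] at hw
  obtain ⟨j, hj, rfl⟩ := exists_eq_update_of_coproductMatrix_ne_zero hn hw
  rw [wordOf_eq_x₂_iff] at hj
  exact ⟨S.erase j, by rw [Finset.card_erase_of_mem hj, hS, Nat.add_sub_cancel],
    update_wordOf_x₁ hn S j⟩

theorem F₁_eq_zero_of_mem_stateSpace_zero (hv : v ∈ stateSpace 𝕜 hn N 0) :
    F₁ 𝕜 hn N q v = 0 := by
  refine (stateSpace_le_iff hn (U := LinearMap.ker (F₁ 𝕜 hn N q))).2 (fun S hS => ?_) hv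
  ext w
  by_contra hw
  rw [F₁, coproductOp_wordVec_apply] at hw
  obtain ⟨j, hj, -⟩ := exists_eq_update_of_coproductMatrix_ne_zero hn hw
  rw [wordOf_eq_x₂_iff, Finset.card_eq_zero.1 hS] at hj
  exact Finset.notMem_empty j hj

theorem weightOp_apply_of_mem_stateSpace (hq : 0 < q) (c : Fin n → ℝ)
    (hv : v ∈ stateSpace 𝕜 hn N m) : weightOp 𝕜 N q c v =
      ((q ^ ((N - m) * c (x₁ hn) + m * c (x₂ hn)) : ℝ) : 𝕜) • v := by
  refine (stateSpace_le_iff hn (U := LinearMap.eqLocus _ (((q ^ ((N - m) * c (x₁ hn) +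
    m * c (x₂ hn)) : ℝ) : 𝕜) • LinearMap.id))).2 (fun S hS => ?_) hv
  rw [LinearMap.mem_eqLocus, weightOp_wordVec hq, sum_comp_wordOf, hS]
  rfl

theorem qH₁_apply_of_mem_stateSpace (hq : 0 < q) (hv : v ∈ stateSpace 𝕜 hn N m) :
    qH₁ 𝕜 hn N q v = ((q ^ ((N : ℤ) - 2 * (m : ℤ)) : ℝ) : 𝕜) • v := by
  rw [qH₁_eq_weightOp, weightOp_apply_of_mem_stateSpace hn hq _ hv, sDiag_x₁, sDiag_x₂,
    ← Real.rpow_intCast]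
  push_cast
  ring_nf

theorem commutator_F₁_E₁_apply (hq : 0 < q) (hv : v ∈ stateSpace 𝕜 hn N m) :
    F₁ 𝕜 hn N q (E₁ 𝕜 hn N q v) - E₁ 𝕜 hn N q (F₁ 𝕜 hn N q v) =
      ((qNum q (N - 2 * m) : ℝ) : 𝕜) • v := by
  refine (stateSpace_le_iff hn (U := LinearMap.eqLocus (F₁ 𝕜 hn N q * E₁ 𝕜 hn N q -
    E₁ 𝕜 hn N q * F₁ 𝕜 hn N q) (((qNum q (N - 2 * m) : ℝ) : 𝕜) • LinearMap.id))).2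
    (fun S hS => ?_) hv
  rw [LinearMap.mem_eqLocus, commutator_F₁_E₁_wordVec hn hq, sum_comp_wordOf, sDiag_x₁, sDiag_x₂,
    hS, LinearMap.smul_apply, LinearMap.id_apply]
  ring_nf

theorem isUnitaryLadder (hq : 0 < q) :
    IsUnitaryLadder q N (E₁ 𝕜 hn N q) (F₁ 𝕜 hn N q) (stateSpace 𝕜 hn N) where
  inner_raise v w := by rw [← adjoint_E₁ hn, LinearMap.adjoint_inner_right]
  isOrtho := isOrtho_stateSpace hn
  raise_mem := E₁_mem_stateSpace hn
  lower_mem := F₁_mem_stateSpace hn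
  commutator_apply := commutator_F₁_E₁_apply hn hq

end StateSpace

section Counting

variable {𝕜 : Type*} [RCLike 𝕜] {n N k m : ℕ} {hn : 2 ≤ n} {q : ℝ}

theorem eigenvalues_eq_realEigenvalues : eigenvalues 𝕜 hn N k q =
    realEigenvalues (hamiltonian 𝕜 n N q) (stateSpace 𝕜 hn N k) := rfl

theorem sectorEigenvalues_eq_realEigenvalues : sectorEigenvalues 𝕜 hn N k q =
    realEigenvalues (hamiltonian 𝕜 n N q)
      (stateSpace 𝕜 hn N k ⊓ LinearMap.ker (F₁ 𝕜 hn N q)) :=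
  Set.ext fun _ => ⟨fun ⟨b, ⟨hb, hb0, hΛ⟩, hF⟩ => ⟨b, ⟨hb, hF⟩, hb0, hΛ⟩,
    fun ⟨b, ⟨hb, hF⟩, hb0, hΛ⟩ => ⟨b, ⟨hb, hb0, hΛ⟩, hF⟩⟩

theorem sectorEigenvalues_zero : sectorEigenvalues 𝕜 hn N 0 q = eigenvalues 𝕜 hn N 0 q := by
  rw [sectorEigenvalues_eq_realEigenvalues, eigenvalues_eq_realEigenvalues,
    inf_eq_left.2 fun b hb => F₁_eq_zero_of_mem_stateSpace_zero hn hb]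

theorem ncard_sectorEigenvalues_succ (hq : 0 < q) (hm : 2 * m < N)
    (hd : (eigenvalues 𝕜 hn N (m + 1) q).ncard = N.choose (m + 1)) :
    (sectorEigenvalues 𝕜 hn N (m + 1) q).ncard + N.choose m = N.choose (m + 1) ∧
      Disjoint (sectorEigenvalues 𝕜 hn N (m + 1) q) (eigenvalues 𝕜 hn N m q) := by
  rw [← finrank_stateSpace (𝕜 := 𝕜) hn] at hd
  have count := (isUnitaryLadder hn hq).ncard_realEigenvalues_inf_ker_lower
    (commute_hamiltonian_F₁ hn hq) hq hm hd
  rwa [finrank_stateSpace, finrank_stateSpace, ← sectorEigenvalues_eq_realEigenvalues] at count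

theorem ncard_sectorEigenvalues (hq : 0 < q) (hk : 2 * k ≤ N)
    (hd : (eigenvalues 𝕜 hn N k q).ncard = N.choose k) :
    ((sectorEigenvalues 𝕜 hn N k q).ncard : ℤ) =
      (N.choose k : ℤ) - (if k = 0 then 0 else (N.choose (k - 1) : ℤ)) := by
  cases k with
  | zero => rw [sectorEigenvalues_zero, hd, if_pos rfl, sub_zero]
  | succ m =>
    rw [if_neg m.succ_ne_zero, Nat.add_sub_cancel,
      ← (ncard_sectorEigenvalues_succ hq (by omega) hd).1, Nat.cast_add, add_sub_cancel_right]

theorem choose_sub_choose_pred (hk : 2 * k ≤ N) :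
    (N.choose k : ℚ) - (if k = 0 then 0 else (N.choose (k - 1) : ℚ)) =
      (N.factorial : ℚ) / ((k.factorial : ℚ) * ((N - k + 1).factorial : ℚ)) *
        ((N : ℚ) - 2 * k + 1) := by
  have hfact (m : ℕ) : (m.factorial : ℚ) ≠ 0 := Nat.cast_ne_zero.2 m.factorial_ne_zero
  obtain ⟨M, rfl⟩ := Nat.exists_eq_add_of_le (show k ≤ N by omega)
  have hM : (M + 1 : ℚ) ≠ 0 := M.cast_add_one_ne_zero
  rw [Nat.add_sub_cancel_left, Nat.factorial_succ]
  cases k with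
  | zero =>
    simp only [if_true, Nat.choose_zero_right, zero_add, Nat.factorial_zero, Nat.cast_mul,
      Nat.cast_add, Nat.cast_one, Nat.cast_zero]
    field_simp [hfact M]
    ring
  | succ m =>
    have hm : (m + 1 : ℚ) ≠ 0 := m.cast_add_one_ne_zero
    rw [if_neg m.succ_ne_zero, Nat.add_sub_cancel, Nat.cast_choose ℚ (by omega),
      Nat.cast_choose ℚ (by omega), Nat.add_sub_cancel_left,
      show m + 1 + M - m = M + 1 by omega, Nat.factorial_succ m, Nat.factorial_succ M]
    push_cast
    field_simp [hfact]
    ring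

theorem F₁_eq_zero_of_mem_sectorEigenvalues (hq : 0 < q) (hk : 2 * k ≤ N)
    (hd : (eigenvalues 𝕜 hn N k q).ncard = N.choose k) {Λ : ℝ}
    (hΛ : Λ ∈ sectorEigenvalues 𝕜 hn N k q) {b : TensorSpace 𝕜 n N}
    (hb : IsEigenstate hn k q Λ b) : F₁ 𝕜 hn N q b = 0 := by
  cases k with
  | zero => exact F₁_eq_zero_of_mem_stateSpace_zero hn hb.1
  | succ m =>
    by_contra hF
    exact Set.disjoint_left.1 (ncard_sectorEigenvalues_succ hq (by omega) hd).2 hΛ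
      ((isUnitaryLadder hn hq).lower_mem_realEigenvalues (commute_hamiltonian_F₁ hn hq) hb.1
        hb.2.2 hF)

end Counting

section Orbit

variable {𝕜 : Type*} [RCLike 𝕜] {n N k : ℕ} {hn : 2 ≤ n} {q : ℝ} {b : TensorSpace 𝕜 n N}

theorem orbitVec_add (i : ℕ) : orbitVec hn k q b (k + i) = (E₁ 𝕜 hn N q ^ i) b := by
  rw [orbitVec, Nat.add_sub_cancel_left]

theorem orbitVec_mem_stateSpace (hq : 0 < q) (hb : b ∈ stateSpace 𝕜 hn N k) {m : ℕ}
    (hkm : k ≤ m) : orbitVec hn k q b m ∈ stateSpace 𝕜 hn N m := by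
  have h := (isUnitaryLadder hn hq).pow_raise_mem hb (m - k)
  rwa [Nat.add_sub_cancel' hkm] at h

theorem orbitSpan_eq_krylovSubspace (hk : 2 * k ≤ N) :
    orbitSpan hn k q b = krylovSubspace (E₁ 𝕜 hn N q) b (N - 2 * k + 1) := by
  rw [orbitSpan, krylovSubspace]
  congr 1
  ext v
  constructor
  · rintro ⟨m, ⟨hkm, hm⟩, rfl⟩
    exact ⟨⟨m - k, by omega⟩, rfl⟩
  · rintro ⟨i, rfl⟩
    exact ⟨k + i, ⟨by omega, by omega⟩, orbitVec_add i.1⟩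

theorem F₁_orbitVec_succ (hq : 0 < q) (hb : b ∈ stateSpace 𝕜 hn N k) (hF : F₁ 𝕜 hn N q b = 0)
    {m : ℕ} (hkm : k ≤ m) (hm : m + 1 ≤ N - k) : F₁ 𝕜 hn N q (orbitVec hn k q b (m + 1)) =
      ((qInt q (N - k - m) * qInt q (m - k + 1) : ℝ) : 𝕜) • orbitVec hn k q b m := by
  obtain ⟨i, rfl⟩ := Nat.exists_eq_add_of_le hkm
  have hcast : ((N - k - (k + i) : ℕ) : ℝ) = N - 2 * k - i := by
    rw [Nat.sub_sub, Nat.cast_sub (by omega)]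
    push_cast
    ring
  rw [add_assoc, orbitVec_add, orbitVec_add, (isUnitaryLadder hn hq).lower_pow_raise_succ hq hb hF,
    qInt_eq_qNum hq, qInt_eq_qNum hq, hcast, Nat.add_sub_cancel_left, Nat.cast_add_one, mul_comm]

theorem E₁_orbitVec_last (hq : 0 < q) (hk : 2 * k ≤ N) (hb : b ∈ stateSpace 𝕜 hn N k)
    (hF : F₁ 𝕜 hn N q b = 0) : E₁ 𝕜 hn N q (orbitVec hn k q b (N - k)) = 0 := by
  rw [show N - k = k + (N - 2 * k) by omega, orbitVec_add, ← Module.End.mul_apply, ← pow_succ']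
  exact (isUnitaryLadder hn hq).pow_raise_eq_zero hq hk hb hF

theorem isEigenstate_orbitVec (hq : 0 < q) {Λ : ℝ} (hb : IsEigenstate hn k q Λ b)
    (hF : F₁ 𝕜 hn N q b = 0) {m : ℕ} (hkm : k ≤ m) (hm : m ≤ N - k) :
    IsEigenstate hn m q Λ (orbitVec hn k q b m) := by
  refine ⟨orbitVec_mem_stateSpace hq hb.1 hkm,
    (isUnitaryLadder hn hq).pow_raise_ne_zero hq hb.1 hF hb.2.1 (by omega), ?_⟩
  rw [orbitVec, ← Module.End.mul_apply, ((commute_hamiltonian_E₁ hn hq).pow_right _).eq,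
    Module.End.mul_apply, hb.2.2, map_smul]

theorem inner_orbitVec (hq : 0 < q) (hb : b ∈ stateSpace 𝕜 hn N k) {m m' : ℕ} (hkm : k ≤ m)
    (hkm' : k ≤ m') (hne : m ≠ m') :
    inner 𝕜 (orbitVec hn k q b m) (orbitVec hn k q b m') = 0 :=
  (isUnitaryLadder hn hq).inner_pow_raise hb (by omega)

end Orbit

section QuantumAlgebra

variable {𝕜 : Type*} [RCLike 𝕜] {n N : ℕ} (hn : 2 ≤ n) {q : ℝ}

theorem qEps_mul_qEps_sq (hq : 0 < q) (t : ℝ) :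
    (qEps 𝕜 N q t (x₁ hn) * qEps 𝕜 N q (-t) (x₂ hn)) ^ 2 = weightOp 𝕜 N q ((2 * t) • sDiag hn) := by
  rw [qEps_eq_weightOp, qEps_eq_weightOp, weightOp_mul hq, pow_two, weightOp_mul hq, sDiag,
    ← two_smul ℝ, mul_smul, smul_sub, ← Pi.single_smul, ← Pi.single_smul, smul_eq_mul, mul_one,
    Pi.single_neg, sub_eq_add_neg]

theorem qEps_mul_qEps_of_add_eq_zero (hq : 0 < q) {s t : ℝ} (h : s + t = 0) (a : Fin n) :
    qEps 𝕜 N q s a * qEps 𝕜 N q t a = 1 := by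
  rw [qEps_eq_weightOp, qEps_eq_weightOp, weightOp_mul hq, ← Pi.single_add, h, Pi.single_zero,
    weightOp_zero hq]

/-- The operators on the tensor space by which the generators of `U_q(gl_2)` act. -/
noncomputable def genOp (𝕜 : Type*) [RCLike 𝕜] {n : ℕ} (hn : 2 ≤ n) (N : ℕ) (q : ℝ) :
    UqGen → Module.End 𝕜 (TensorSpace 𝕜 n N)
  | .e => E₁ 𝕜 hn N q
  | .f => F₁ 𝕜 hn N q
  | .kPos i => qEps 𝕜 N q (1 / 2) (![x₁ hn, x₂ hn] i)
  | .kNeg i => qEps 𝕜 N q (-(1 / 2)) (![x₁ hn, x₂ hn] i)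

theorem lift_genOp_eq_of_uqRel (hq : 0 < q) (hq1 : q ≠ 1) {x y : FreeAlgebra 𝕜 UqGen}
    (h : UqRel 𝕜 q x y) :
    FreeAlgebra.lift 𝕜 (genOp 𝕜 hn N q) x = FreeAlgebra.lift 𝕜 (genOp 𝕜 hn N q) y := by
  have hne := x₁_ne_x₂ hn
  cases h with
  | pos_neg i | neg_pos i =>
    simp only [map_mul, map_one, FreeAlgebra.lift_ι_apply, genOp]
    exact qEps_mul_qEps_of_add_eq_zero hq (by norm_num) _
  | comm =>
    simp only [map_mul, FreeAlgebra.lift_ι_apply, genOp, qEps_eq_weightOp, weightOp_mul hq,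
      add_comm]
  | k_f₁ | k_f₂ | k_e₁ | k_e₂ =>
    simp only [map_mul, map_smul, FreeAlgebra.lift_ι_apply, genOp, qEps_eq_weightOp, E₁, F₁,
      weightOp_mul_coproductOp hn hq, Matrix.cons_val_zero, Matrix.cons_val_one,
      Pi.single_eq_same, Pi.single_eq_of_ne hne, Pi.single_eq_of_ne hne.symm, sub_zero, zero_sub]
  | f_e =>
    have hsq := qEps_mul_qEps_sq (𝕜 := 𝕜) (N := N) hn hq (1 / 2)
    have hsq_inv := qEps_mul_qEps_sq (𝕜 := 𝕜) (N := N) hn hq (-(1 / 2))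
    rw [neg_neg] at hsq_inv
    simp only [map_sub, map_mul, map_smul, map_pow, FreeAlgebra.lift_ι_apply, genOp, freeQHalfH,
      freeQHalfHInv, Matrix.cons_val_zero, Matrix.cons_val_one, hsq, hsq_inv,
      commutator_F₁_E₁_eq_weightOp hn hq hq1]
    norm_num

/-- The action of `U_q(gl_2)` on the tensor space; the relation between `e` and `f` makes sense
only for `q ≠ 1`. -/
noncomputable def tensorAction (𝕜 : Type*) [RCLike 𝕜] {n : ℕ} (hn : 2 ≤ n) (N : ℕ) {q : ℝ}
    (hq : 0 < q) (hq1 : q ≠ 1) : UqGl₂ 𝕜 q →ₐ[𝕜] Module.End 𝕜 (TensorSpace 𝕜 n N) :=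
  RingQuot.liftAlgHom 𝕜
    ⟨FreeAlgebra.lift 𝕜 (genOp 𝕜 hn N q), fun _ _ => lift_genOp_eq_of_uqRel hn hq hq1⟩

theorem tensorAction_gen (hq : 0 < q) (hq1 : q ≠ 1) (g : UqGen) :
    tensorAction 𝕜 hn N hq hq1 (UqGl₂.gen 𝕜 q g) = genOp 𝕜 hn N q g := by
  rw [tensorAction, UqGl₂.gen, RingQuot.liftAlgHom_mkAlgHom_apply, FreeAlgebra.lift_ι_apply]

theorem UqGl₂.apply_mem_of_forall_gen {M : Type*} [AddCommGroup M] [Module 𝕜 M]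
    {ρ : UqGl₂ 𝕜 q →ₐ[𝕜] Module.End 𝕜 M} {V : Submodule 𝕜 M}
    (hV : ∀ g, ∀ v ∈ V, ρ (UqGl₂.gen 𝕜 q g) v ∈ V) (u : UqGl₂ 𝕜 q) {v : M} (hv : v ∈ V) :
    ρ u v ∈ V := by
  obtain ⟨x, rfl⟩ := RingQuot.mkAlgHom_surjective 𝕜 (UqRel 𝕜 q) u
  induction x using FreeAlgebra.induction generalizing v with
  | grade0 r =>
    rw [AlgHom.commutes, AlgHom.commutes, Module.algebraMap_end_apply]
    exact V.smul_mem r hv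
  | grade1 g => exact hV g v hv
  | mul x y hx hy =>
    rw [map_mul, map_mul, Module.End.mul_apply]
    exact hx (hy hv)
  | add x y hx hy =>
    rw [map_add, map_add, LinearMap.add_apply]
    exact V.add_mem (hx hv) (hy hv)

/-- The restriction of a representation to an invariant subspace. -/
def restrictAction {R A M : Type*} [CommSemiring R] [Semiring A] [Algebra R A] [AddCommMonoid M]
    [Module R M] (ρ : A →ₐ[R] Module.End R M) (V : Submodule R M)
    (hV : ∀ a, ∀ v ∈ V, ρ a v ∈ V) : A →ₐ[R] Module.End R V where
  toFun a := (ρ a).restrict (hV a)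
  map_one' := by ext; simp
  map_mul' a b := by ext; simp
  map_zero' := by ext; simp
  map_add' a b := by ext; simp
  commutes' r := by ext; simp

theorem exists_isRestrictedAction (hq : 0 < q) (hq1 : q ≠ 1)
    {V : Submodule 𝕜 (TensorSpace 𝕜 n N)} (hE : ∀ v ∈ V, E₁ 𝕜 hn N q v ∈ V)
    (hF : ∀ v ∈ V, F₁ 𝕜 hn N q v ∈ V) (hc : ∀ c, ∀ v ∈ V, weightOp 𝕜 N q c v ∈ V) :
    ∃ ρ : UqGl₂ 𝕜 q →ₐ[𝕜] Module.End 𝕜 V, IsRestrictedAction hn ρ := by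
  have hgen (g : UqGen) : ∀ v ∈ V, tensorAction 𝕜 hn N hq hq1 (UqGl₂.gen 𝕜 q g) v ∈ V := by
    rw [tensorAction_gen]
    cases g with
    | e => exact hE
    | f => exact hF
    | kPos i | kNeg i => exact hc _
  refine ⟨restrictAction (tensorAction 𝕜 hn N hq hq1) V fun u _ =>
    UqGl₂.apply_mem_of_forall_gen hgen u, fun v => ?_⟩
  have hcoe (g : UqGen) : (restrictAction (tensorAction 𝕜 hn N hq hq1) V (fun u _ =>
      UqGl₂.apply_mem_of_forall_gen hgen u) (UqGl₂.gen 𝕜 q g) v : TensorSpace 𝕜 n N) =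
      genOp 𝕜 hn N q g v := by
    rw [← tensorAction_gen hn hq hq1]
    rfl
  simp only [hcoe]
  exact ⟨rfl, rfl, rfl, rfl, rfl, rfl⟩

namespace IsRestrictedAction

variable {hn} {V : Submodule 𝕜 (TensorSpace 𝕜 n N)} {ρ : UqGl₂ 𝕜 q →ₐ[𝕜] Module.End 𝕜 V}
  (hρ : IsRestrictedAction hn ρ)

include hρ

theorem coe_qh_apply (hq : 0 < q) (v : V) :
    (ρ (UqGl₂.qh 𝕜 q) v : TensorSpace 𝕜 n N) = qH₁ 𝕜 hn N q v := by
  have hpos (v : V) := (hρ v).2.2.1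
  have hneg (v : V) := (hρ v).2.2.2.2.2
  have hsq := qEps_mul_qEps_sq (𝕜 := 𝕜) (N := N) hn hq (1 / 2)
  rw [mul_one_div_cancel two_ne_zero, one_smul] at hsq
  rw [qH₁_eq_weightOp, ← hsq, UqGl₂.qh]
  simp only [pow_two, map_mul, Module.End.mul_apply, hpos, hneg]

theorem isIrreducibleRep [Nontrivial V] (hV : ∀ W ≤ V,
    (∀ w ∈ W, E₁ 𝕜 hn N q w ∈ W ∧ F₁ 𝕜 hn N q w ∈ W) → W = ⊥ ∨ W = V) :
    IsIrreducibleRep ρ := by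
  refine ⟨‹_›, fun W hW => ?_⟩
  have hinj := Submodule.map_injective_of_injective V.injective_subtype
  have hmap := hV (W.map V.subtype) (Submodule.map_subtype_le _ _) <| by
    rintro _ ⟨w, hw, rfl⟩
    exact ⟨⟨_, hW _ w hw, (hρ w).1⟩, ⟨_, hW _ w hw, (hρ w).2.1⟩⟩
  refine hmap.imp (fun h => hinj ?_) fun h => hinj ?_
  · rw [h, Submodule.map_bot]
  · rw [h, Submodule.map_subtype_top]

end IsRestrictedAction

section OrbitModule

variable {k : ℕ} {hn} {b : TensorSpace 𝕜 n N}

theorem E₁_mem_orbitSpan (hq : 0 < q) (hk : 2 * k ≤ N) (hb : b ∈ stateSpace 𝕜 hn N k)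
    (hF : F₁ 𝕜 hn N q b = 0) : ∀ v ∈ orbitSpan hn k q b, E₁ 𝕜 hn N q v ∈ orbitSpan hn k q b := by
  rw [orbitSpan_eq_krylovSubspace hk]
  exact fun v => apply_mem_krylovSubspace
    ((isUnitaryLadder hn hq).pow_raise_eq_zero hq hk hb hF)

theorem F₁_mem_orbitSpan (hq : 0 < q) (hk : 2 * k ≤ N) (hb : b ∈ stateSpace 𝕜 hn N k)
    (hF : F₁ 𝕜 hn N q b = 0) : ∀ v ∈ orbitSpan hn k q b, F₁ 𝕜 hn N q v ∈ orbitSpan hn k q b := by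
  rw [orbitSpan_eq_krylovSubspace hk]
  exact fun v => (isUnitaryLadder hn hq).lower_mem_krylovSubspace hq hb hF

theorem eq_bot_or_eq_orbitSpan (hq : 0 < q) (hk : 2 * k ≤ N) (hb : b ∈ stateSpace 𝕜 hn N k)
    (hF : F₁ 𝕜 hn N q b = 0) {W : Submodule 𝕜 (TensorSpace 𝕜 n N)}
    (hWV : W ≤ orbitSpan hn k q b) (hW : ∀ w ∈ W, E₁ 𝕜 hn N q w ∈ W ∧ F₁ 𝕜 hn N q w ∈ W) :
    W = ⊥ ∨ W = orbitSpan hn k q b := by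
  rw [orbitSpan_eq_krylovSubspace hk] at hWV ⊢
  exact (isUnitaryLadder hn hq).eq_bot_or_eq_krylovSubspace hq hb hF hWV
    (fun w hw => (hW w hw).1) fun w hw => (hW w hw).2

theorem weightOp_mem_orbitSpan (hq : 0 < q) (hb : b ∈ stateSpace 𝕜 hn N k) (c : Fin n → ℝ) :
    ∀ v ∈ orbitSpan hn k q b, weightOp 𝕜 N q c v ∈ orbitSpan hn k q b := by
  refine Submodule.span_le (p := (orbitSpan hn k q b).comap (weightOp 𝕜 N q c)).2 ?_
  rintro _ ⟨m, hm, rfl⟩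
  rw [SetLike.mem_coe, Submodule.mem_comap,
    weightOp_apply_of_mem_stateSpace hn hq c (orbitVec_mem_stateSpace hq hb hm.1)]
  exact Submodule.smul_mem _ _ (Submodule.subset_span ⟨m, hm, rfl⟩)

theorem exists_basis_orbitSpan (hq : 0 < q) (hk : 2 * k ≤ N) (hb : b ∈ stateSpace 𝕜 hn N k)
    (hF : F₁ 𝕜 hn N q b = 0) (hb0 : b ≠ 0) :
    ∃ β : Module.Basis (Fin (N - 2 * k + 1)) 𝕜 (orbitSpan hn k q b),
      ∀ i, (β i : TensorSpace 𝕜 n N) = orbitVec hn k q b (k + i.1) := by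
  have hli := (isUnitaryLadder hn hq).linearIndependent_pow_raise hq hk hb hF hb0
  rw [orbitSpan_eq_krylovSubspace hk]
  exact ⟨Module.Basis.span hli, fun i =>
    (congrArg Subtype.val (Module.Basis.span_apply hli i)).trans (orbitVec_add i.1).symm⟩

theorem nontrivial_orbitSpan (hk : 2 * k ≤ N) (hb0 : b ≠ 0) :
    Nontrivial (orbitSpan hn k q b) := by
  refine Submodule.nontrivial_iff_ne_bot.2 ((Submodule.ne_bot_iff _).2 ⟨b, ?_, hb0⟩)
  rw [orbitSpan_eq_krylovSubspace hk]
  exact pow_apply_mem_krylovSubspace (i := 0) (by omega)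

theorem IsRestrictedAction.isCanonicalBasis {V : Submodule 𝕜 (TensorSpace 𝕜 n N)}
    {ρ : UqGl₂ 𝕜 q →ₐ[𝕜] Module.End 𝕜 V} (hρ : IsRestrictedAction hn ρ) (hq : 0 < q)
    (hk : 2 * k ≤ N) (hb : b ∈ stateSpace 𝕜 hn N k) (hF : F₁ 𝕜 hn N q b = 0)
    {β : Module.Basis (Fin (N - 2 * k + 1)) 𝕜 V}
    (hβ : ∀ i, (β i : TensorSpace 𝕜 n N) = orbitVec hn k q b (k + i.1)) :
    IsCanonicalBasis ρ β := by
  have hE (v : V) := (hρ v).1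
  have hF' (v : V) := (hρ v).2.1
  refine ⟨fun i hi => Subtype.ext ?_, fun i hi => Subtype.ext ?_, fun i j hij => Subtype.ext ?_,
    fun i j hij => Subtype.ext ?_, fun i => Subtype.ext ?_⟩
  · rw [hF', hβ, orbitVec_add, hi, pow_zero, Module.End.one_apply, hF, Submodule.coe_zero]
  · rw [hE, hβ, show k + i.1 = N - k by omega, E₁_orbitVec_last hq hk hb hF, Submodule.coe_zero]
  · rw [hE, hβ, hβ, hij, orbitVec_add, orbitVec_add, pow_succ', Module.End.mul_apply]
  · rw [hF', Submodule.coe_smul, hβ, hβ, hij, ← add_assoc,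
      F₁_orbitVec_succ hq hb hF (by omega) (by omega), mul_comm, Nat.add_sub_cancel_left,
      show N - k - (k + i.1) = N - 2 * k + 1 - 1 - i.1 by omega]
  · rw [hρ.coe_qh_apply hq, Submodule.coe_smul, hβ,
      qH₁_apply_of_mem_stateSpace hn hq (orbitVec_mem_stateSpace hq hb (by omega))]
    congr 3
    omega

end OrbitModule

end QuantumAlgebra

end SpinChain

theorem theorem7p1 (𝕜 : Type*) [RCLike 𝕜] (n N k : ℕ) (hn : 2 ≤ n) (hk : 2 * k ≤ N)
    (q : ℝ) (hq : 0 < q)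
    -- the eigenvalue problem, of size `binom(N, k)`, has distinct eigenvalues
    (hdistinct : (SpinChain.eigenvalues 𝕜 hn N k q).ncard = N.choose k) :
    -- (1) the number of eigenvalues in the `k`-sector, in both forms
    (((SpinChain.sectorEigenvalues 𝕜 hn N k q).ncard : ℤ)
        = (N.choose k : ℤ) - (if k = 0 then 0 else (N.choose (k - 1) : ℤ))) ∧
    (((SpinChain.sectorEigenvalues 𝕜 hn N k q).ncard : ℚ)
        = (N.factorial : ℚ) / ((k.factorial : ℚ) * ((N - k + 1).factorial : ℚ))
            * ((N : ℚ) - 2 * k + 1)) ∧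
    -- the eigenstates of these eigenvalues are highest-weight vectors
    (∀ Λ ∈ SpinChain.sectorEigenvalues 𝕜 hn N k q, ∀ b : SpinChain.TensorSpace 𝕜 n N,
        SpinChain.IsEigenstate hn k q Λ b → SpinChain.F₁ 𝕜 hn N q b = 0) ∧
    -- the orbit of each such eigenstate `b`
    (∀ (Λ : ℝ) (b : SpinChain.TensorSpace 𝕜 n N),
        SpinChain.IsEigenstate hn k q Λ b → SpinChain.F₁ 𝕜 hn N q b = 0 →
      -- (2)
      (∀ m, k ≤ m → m + 1 ≤ N - k →
        SpinChain.F₁ 𝕜 hn N q (SpinChain.orbitVec hn k q b (m + 1))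
          = ((SpinChain.qInt q (N - k - m) * SpinChain.qInt q (m - k + 1) : ℝ) : 𝕜) •
              SpinChain.orbitVec hn k q b m) ∧
      SpinChain.E₁ 𝕜 hn N q (SpinChain.orbitVec hn k q b (N - k)) = 0 ∧
      (∀ m, k ≤ m → m ≤ N - k →
        SpinChain.qH₁ 𝕜 hn N q (SpinChain.orbitVec hn k q b m)
          = ((q ^ ((N : ℤ) - 2 * (m : ℤ)) : ℝ) : 𝕜) • SpinChain.orbitVec hn k q b m) ∧
      -- (3) the orbit consists of pairwise orthogonal eigenstates with the same eigenvalue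
      (∀ m, k ≤ m → m ≤ N - k →
        SpinChain.IsEigenstate hn m q Λ (SpinChain.orbitVec hn k q b m)) ∧
      (∀ m m', k ≤ m → m ≤ N - k → k ≤ m' → m' ≤ N - k → m ≠ m' →
        inner 𝕜 (SpinChain.orbitVec hn k q b m) (SpinChain.orbitVec hn k q b m') = 0) ∧
      -- it is a basis of an `(N - 2k + 1)`-dimensional space `V`
      ∃ β : Module.Basis (Fin (N - 2 * k + 1)) 𝕜 (SpinChain.orbitSpan hn k q b),
        (∀ i, (β i : SpinChain.TensorSpace 𝕜 n N) = SpinChain.orbitVec hn k q b (k + i.1)) ∧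
        -- `V` is invariant under `E_1` and `F_1`, and irreducible under them
        (∀ v ∈ SpinChain.orbitSpan hn k q b,
          SpinChain.E₁ 𝕜 hn N q v ∈ SpinChain.orbitSpan hn k q b ∧
          SpinChain.F₁ 𝕜 hn N q v ∈ SpinChain.orbitSpan hn k q b) ∧
        (∀ W ≤ SpinChain.orbitSpan hn k q b,
          (∀ w ∈ W, SpinChain.E₁ 𝕜 hn N q w ∈ W ∧ SpinChain.F₁ 𝕜 hn N q w ∈ W) →
          W = ⊥ ∨ W = SpinChain.orbitSpan hn k q b) ∧
        -- for `q ≠ 1`, `V` is an irreducible `U_q(gl_2)`-module with canonical basis `β`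
        (q ≠ 1 → ∃ ρ : SpinChain.UqGl₂ 𝕜 q →ₐ[𝕜]
            Module.End 𝕜 (SpinChain.orbitSpan hn k q b),
          SpinChain.IsRestrictedAction hn ρ ∧ SpinChain.IsIrreducibleRep ρ ∧
            SpinChain.IsCanonicalBasis ρ β)) := by
  refine ⟨SpinChain.ncard_sectorEigenvalues hq hk hdistinct, ?_,
    fun Λ hΛ b => SpinChain.F₁_eq_zero_of_mem_sectorEigenvalues hq hk hdistinct hΛ,
    fun Λ b hb hF => ⟨fun m => SpinChain.F₁_orbitVec_succ hq hb.1 hF,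
      SpinChain.E₁_orbitVec_last hq hk hb.1 hF,
      fun m hkm _ => SpinChain.qH₁_apply_of_mem_stateSpace hn hq
        (SpinChain.orbitVec_mem_stateSpace hq hb.1 hkm),
      fun m => SpinChain.isEigenstate_orbitVec hq hb hF,
      fun m m' hkm _ hkm' _ => SpinChain.inner_orbitVec hq hb.1 hkm hkm', ?_⟩⟩
  · rw [← SpinChain.choose_sub_choose_pred hk]
    exact_mod_cast congrArg (Int.cast : ℤ → ℚ) (SpinChain.ncard_sectorEigenvalues hq hk hdistinct)
  · obtain ⟨β, hβ⟩ := SpinChain.exists_basis_orbitSpan hq hk hb.1 hF hb.2.1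
    have invariantE := SpinChain.E₁_mem_orbitSpan hq hk hb.1 hF
    have invariantF := SpinChain.F₁_mem_orbitSpan hq hk hb.1 hF
    have irreducible := fun W => SpinChain.eq_bot_or_eq_orbitSpan hq hk hb.1 hF (W := W)
    refine ⟨β, hβ, fun v hv => ⟨invariantE v hv, invariantF v hv⟩, irreducible, fun hq1 => ?_⟩
    have := SpinChain.nontrivial_orbitSpan (hn := hn) (q := q) hk hb.2.1
    obtain ⟨ρ, hρ⟩ := SpinChain.exists_isRestrictedAction hn hq hq1 invariantE invariantF
      (SpinChain.weightOp_mem_orbitSpan hq hb.1)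
    exact ⟨ρ, hρ, hρ.isIrreducibleRep irreducible, hρ.isCanonicalBasis hq hk hb.1 hF hβ⟩
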